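/- Let $d\in\mathbb N$, $T>0$, $\alpha\in(\tfrac12,\tfrac32)$ and $k_2(x)=x^{\alpha-1}/\Gamma(\alpha)$ for $x>0$. Let $(\Omega,\mathcal F,\mathbb P)$ be a probability space with a filtration $(\mathcal F_t)_{t\in[0,T]}$ satisfying the usual conditions (complete and right-continuous), and let $W$ be a standard $\mathbb R^d$-valued Brownian motion with respect to it. Put $H=L^2(0,T;\mathbb R^d)$, $H_\square=L^2((0,T)\times(0,T);\mathbb R^d)$ with norm $\|\cdot\|_{2,\square}$, and $\Lambda=C([0,T];\mathbb R^d)$. For $t\in[0,T]$ let $\sigma(t)\colon\mathbb R^d\to H$ be the bounded linear operator $[\sigma(t)x](\xi)=k_2(\xi-t)1_{\{t<\xi\}}x$. For $q\ge 2$ (a real number) let $\mathcal H^q=L^q(\Omega;H)$ and let $\mathcal H^q_t\subset\mathcal H^q$ be the subspace of $\mathcal F_t$-measurable elements. Let $B\colon\Lambda\to H_\square$ satisfy, for some constant $C_0>0$ and all $w_1,w_2\in\Lambda$, $$\|B(w_1)\|_{2,\square}\le C_0(1+\|w_1\|_2),\qquad \|B(w_1)-B(w_2)\|_{2,\square}\le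 C_0\|w_1-w_2\|_2,$$ where $\|\cdot\|_2$ is the norm of $H$. Suppose moreover that, for every $0<t\le T$: for every $w\in\Lambda$ and a.e. $r\in(0,t)$ one has $B(w)(r,\xi)=0$ for a.e. $\xi\in(0,r)$; and whenever $w_1=w_2$ on $(0,t)$, one has $B(w_1)(r,\cdot)=B(w_2)(r,\cdot)$ in $H$ for a.e. $r\in(0,t)$. Let $\bar B\colon H\to H_\square$ be the unique continuous map extending $B$, and write $\bar B(r,w)=\bar B(w)(r,\cdot)\in H$, which is defined for a.e. $r\in(0,T)$. Then for every $q\ge 2$, every $\phi\in\mathcal H^q$ and all $0\le s\le t\le T$, the equation $$w=\phi+\int_s^t\bar B(r,w)\,\mathrm dr+\int_s^t\sigma(r)\,\mathrm dW_r\qquad\mathbb P\text{-a.s.}$$ (the first integral being a Bochner integral in $H$, the second an It\^o integral with values in $H$) has a unique solution $w=w^{s,\phi}_t$ in $\mathcal H^q$. If $\phi\in\mathcal H^q_s$, then $w^{s,\phi}_t\in\mathcal H^q_t$. Furthermore, the cocycle property $$w^{s,\phi}_t=w^{u,\,w^{s,\phi}_u}_t\quad\text{in }\mathcal H^q$$ holds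 for all $0\le s\le u\le t\le T$ and all $\phi\in\mathcal H^q$. -/

import Mathlib

open MeasureTheory ProbabilityTheory Filter Topology
open scoped NNReal ENNReal

noncomputable section

namespace VolterraSDE

/-! ### The spaces -/

/-- Euclidean space `ℝ^d`. -/
abbrev Rd (d : ℕ) : Type := EuclideanSpace ℝ (Fin d)

/-- Lebesgue measure on `(0, T)`. -/
abbrev lebT (T : ℝ≥0) : Measure ℝ := volume.restrict (Set.Ioo (0 : ℝ) T)

/-- `H = L²(0, T; ℝ^d)`. -/
abbrev HSpace (d : ℕ) (T : ℝ≥0) : Type := Lp (Rd d) 2 (lebT T)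

/-- `L²((0, T) × (0, T); ℝ^d)`, with its norm `‖·‖_{2,□}`. -/
abbrev HSqSpace (d : ℕ) (T : ℝ≥0) : Type := Lp (Rd d) 2 ((lebT T).prod (lebT T))

/-- `Λ = C([0, T]; ℝ^d)`. -/
abbrev PathSpace (d : ℕ) (T : ℝ≥0) : Type := C(Set.Icc (0 : ℝ) T, Rd d)

/-- `ℋ^q = L^q(Ω; H)`. -/
abbrev RandomH {Ω : Type*} [MeasurableSpace Ω] (P : Measure Ω) (d : ℕ) (T q : ℝ≥0) : Type _ :=
  Lp (HSpace d T) q P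

theorem PathSpace.memLp {d : ℕ} {T : ℝ≥0} (w : PathSpace d T) :
    MemLp (fun ξ : ℝ => w (Set.projIcc (0 : ℝ) T T.coe_nonneg ξ)) 2 (lebT T) := by
  refine MemLp.of_bound (C := ‖w‖) ?_ ?_
  · exact (w.continuous.comp continuous_projIcc).aestronglyMeasurable
  · exact Eventually.of_forall fun ξ => w.norm_coe_le_norm _

/-- The class in `H` of a continuous path (`projIcc` is the identity on `[0, T]`). -/
def PathSpace.toH {d : ℕ} {T : ℝ≥0} (w : PathSpace d T) : HSpace d T :=
  w.memLp.toLp _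

/-- For `f ∈ L²((0, T)²; ℝ^d)` and `r`, the function `f(r, ·)` as an element of `H`; it is
a genuine section for almost every `r`. -/
def slice {d : ℕ} {T : ℝ≥0} (f : HSqSpace d T) (r : ℝ) : HSpace d T :=
  open Classical in
  if h : MemLp (fun ξ : ℝ => f (r, ξ)) 2 (lebT T) then h.toLp _ else 0

/-! ### The drift -/

/-- The standing assumption on the drift `B : Λ → L²((0, T)²; ℝ^d)`: linear growth and Lipschitz
continuity with respect to the `L²` norms, and the Volterra property. -/
structure DriftAssumption {d : ℕ} {T : ℝ≥0} (B : PathSpace d T → HSqSpace d T) : Prop where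
  bound : ∃ C₀ : ℝ, 0 < C₀ ∧
    (∀ w : PathSpace d T, ‖B w‖ ≤ C₀ * (1 + ‖w.toH‖)) ∧
    (∀ w₁ w₂ : PathSpace d T, ‖B w₁ - B w₂‖ ≤ C₀ * ‖w₁.toH - w₂.toH‖)
  volterra : ∀ (w : PathSpace d T) (t : ℝ), 0 < t → t ≤ T →
    ∀ᵐ r ∂(volume.restrict (Set.Ioo (0 : ℝ) t)), ∀ᵐ ξ ∂(volume.restrict (Set.Ioo (0 : ℝ) r)),
      B w (r, ξ) = 0
  causal : ∀ (w₁ w₂ : PathSpace d T) (t : ℝ), 0 < t → t ≤ T →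
    (∀ x : Set.Icc (0 : ℝ) T, (x : ℝ) ∈ Set.Ioo (0 : ℝ) t → w₁ x = w₂ x) →
    ∀ᵐ r ∂(volume.restrict (Set.Ioo (0 : ℝ) t)), ∀ᵐ ξ ∂(lebT T), B w₁ (r, ξ) = B w₂ (r, ξ)

theorem PathSpace.denseRange_toH (d : ℕ) (T : ℝ≥0) :
    DenseRange (PathSpace.toH : PathSpace d T → HSpace d T) := by
  have h := BoundedContinuousFunction.toLp_denseRange (Rd d) (lebT T) ℝ (p := 2) (by simp)
  refine h.mono ?_
  rintro _ ⟨g, rfl⟩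
  refine ⟨⟨fun x => g x, by fun_prop⟩, ?_⟩
  refine Lp.ext ?_
  have h1 := (PathSpace.memLp (⟨fun x => g x, by fun_prop⟩ : PathSpace d T)).coeFn_toLp
  have h2 := BoundedContinuousFunction.coeFn_toLp 2 (lebT T) ℝ g
  have h3 : ∀ᵐ ξ ∂(lebT T), ξ ∈ Set.Ioo (0 : ℝ) T := ae_restrict_mem measurableSet_Ioo
  filter_upwards [h1, h2, h3] with ξ e1 e2 hξ
  rw [e2]
  refine e1.trans ?_
  simp [Set.projIcc_of_mem T.coe_nonneg (Set.Ioo_subset_Icc_self hξ)]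

theorem existsUnique_extension {d : ℕ} {T : ℝ≥0} {B : PathSpace d T → HSqSpace d T}
    (hB : DriftAssumption B) :
    ∃! Bbar : HSpace d T → HSqSpace d T,
      Continuous Bbar ∧ ∀ w : PathSpace d T, Bbar w.toH = B w := by
  obtain ⟨C, hC, -, hL⟩ := hB.bound
  have hd := PathSpace.denseRange_toH d T
  have key : ∀ w : PathSpace d T, ∀ x : Set.range (PathSpace.toH (d := d) (T := T)),
      (x : HSpace d T) = w.toH → B x.2.choose = B w := by
    intro w x hx
    have h := hL x.2.choose w
    have e : PathSpace.toH x.2.choose = w.toH := x.2.choose_spec.trans hx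
    have h' : ‖B x.2.choose - B w‖ ≤ 0 := by
      refine h.trans (le_of_eq ?_)
      rw [sub_eq_zero.mpr e, norm_zero, mul_zero]
    exact sub_eq_zero.mp (norm_le_zero_iff.mp h')
  let g : Set.range (PathSpace.toH (d := d) (T := T)) → HSqSpace d T := fun x => B x.2.choose
  have hg : LipschitzWith ⟨C, hC.le⟩ g := by
    refine LipschitzWith.of_dist_le_mul fun x y => ?_
    have ex : PathSpace.toH x.2.choose = (x : HSpace d T) := x.2.choose_spec
    have ey : PathSpace.toH y.2.choose = (y : HSpace d T) := y.2.choose_spec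
    rw [dist_eq_norm, Subtype.dist_eq, dist_eq_norm, ← ex, ← ey]
    exact hL x.2.choose y.2.choose
  have hui : IsUniformInducing (Subtype.val : Set.range (PathSpace.toH (d := d) (T := T)) → _) :=
    isUniformEmbedding_subtype_val.isUniformInducing
  have hdr : DenseRange (Subtype.val : Set.range (PathSpace.toH (d := d) (T := T)) → _) :=
    hd.denseRange_val
  refine ⟨(hui.isDenseInducing hdr).extend g, ⟨?_, ?_⟩, ?_⟩
  · exact (uniformContinuous_uniformly_extend hui hdr hg.uniformContinuous).continuous
  · intro w
    have h := uniformly_extend_of_ind hui hdr hg.uniformContinuous ⟨w.toH, ⟨w, rfl⟩⟩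
    exact h.trans (key w _ rfl)
  · rintro f ⟨hf, hfB⟩
    refine (uniformly_extend_unique hui hdr (f := g) ?_ hf).symm
    rintro ⟨_, w, rfl⟩
    exact (hfB w).trans (key w _ rfl).symm

/-- `B̄ : H → L²((0, T)²; ℝ^d)`, the unique continuous extension of `B`. -/
def driftExtension {d : ℕ} {T : ℝ≥0} {B : PathSpace d T → HSqSpace d T}
    (hB : DriftAssumption B) : HSpace d T → HSqSpace d T :=
  (existsUnique_extension hB).choose

theorem driftExtension_spec {d : ℕ} {T : ℝ≥0} {B : PathSpace d T → HSqSpace d T}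
    (hB : DriftAssumption B) :
    Continuous (driftExtension hB) ∧ ∀ w : PathSpace d T, driftExtension hB w.toH = B w :=
  (existsUnique_extension hB).choose_spec.1

/-! ### The noise -/

/-- `ξ ↦ k₂(ξ - t) 1_{t < ξ}` with the fractional kernel `k₂(x) = x^(α - 1) / Γ(α)`. -/
def fracKernel (α t ξ : ℝ) : ℝ :=
  if t < ξ then (ξ - t) ^ (α - 1) / Real.Gamma α else 0

theorem fracKernel_memLp {α : ℝ} (hα : 1 / 2 < α) (T : ℝ≥0) (t : ℝ) :
    MemLp (fracKernel α t) 2 (lebT T) := by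
  have hm : Measurable (fracKernel α t) := by
    unfold fracKernel
    exact Measurable.ite measurableSet_Ioi (by fun_prop) measurable_const
  rw [memLp_two_iff_integrable_sq hm.aestronglyMeasurable]
  have h0 : IntervalIntegrable (fun x : ℝ => x ^ (2 * α - 2)) volume (0 - t) (T - t) :=
    intervalIntegral.intervalIntegrable_rpow' (by linarith)
  have h1 : IntervalIntegrable (fun ξ : ℝ => (ξ - t) ^ (2 * α - 2)) volume 0 T := by
    simpa using h0.comp_sub_right t
  have h2 : Integrable (fun ξ : ℝ => (ξ - t) ^ (2 * α - 2)) (lebT T) := by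
    rw [intervalIntegrable_iff, Set.uIoc_of_le T.coe_nonneg] at h1
    exact h1.mono_set Set.Ioo_subset_Ioc_self
  have h3 := (h2.norm.mul_const ((Real.Gamma α)⁻¹ ^ 2))
  refine h3.mono' (hm.pow_const 2).aestronglyMeasurable (Eventually.of_forall fun ξ => ?_)
  unfold fracKernel
  split_ifs with h
  · have hp : 0 < ξ - t := sub_pos.mpr h
    have e : ((ξ - t) ^ (α - 1)) ^ 2 = (ξ - t) ^ (2 * α - 2) := by
      rw [← Real.rpow_natCast, ← Real.rpow_mul hp.le]
      congr 1
      push_cast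
      ring
    rw [div_pow, e, inv_pow, ← div_eq_mul_inv, Real.norm_of_nonneg, Real.norm_of_nonneg]
    · positivity
    · positivity
  · simp only [ne_eq, OfNat.ofNat_ne_zero, not_false_eq_true, zero_pow, norm_zero]
    positivity

theorem fracKernel_smul_memLp (d : ℕ) {α : ℝ} (hα : 1 / 2 < α) (T : ℝ≥0) (t : ℝ) (x : Rd d) :
    MemLp (fun ξ => fracKernel α t ξ • x) 2 (lebT T) := by
  simpa [Function.comp_def] using
    (ContinuousLinearMap.toSpanSingleton ℝ x).comp_memLp' (fracKernel_memLp hα T t)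

/-- `σ(t) ∈ 𝓛(ℝ^d; H)`, `[σ(t) x](ξ) = k₂(ξ - t) 1_{t < ξ} x`. -/
def noiseCoeff (d : ℕ) (T : ℝ≥0) {α : ℝ} (hα : 1 / 2 < α) (t : ℝ) :
    Rd d →L[ℝ] HSpace d T :=
  LinearMap.toContinuousLinearMap
    { toFun := fun x => (fracKernel_smul_memLp d hα T t x).toLp (fun ξ => fracKernel α t ξ • x)
      map_add' := fun x y => by
        rw [← MemLp.toLp_add]
        congr 1
        funext ξ
        simp
      map_smul' := fun c x => by
        rw [RingHom.id_apply, ← MemLp.toLp_const_smul]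
        congr 1
        funext ξ
        simp only [Pi.smul_apply]
        exact smul_comm _ _ _ }

/-! ### The probabilistic setting -/

/-- The usual conditions for a filtration indexed by `[0, T]`: it is complete (every subset of a
`P`-null set belongs to `𝓕 0`) and right-continuous. -/
structure UsualConditions {Ω : Type*} {m : MeasurableSpace Ω} {T : ℝ≥0}
    (𝓕 : Filtration (Set.Iic T) m) (P : Measure Ω) : Prop where
  complete : ∀ A : Set Ω, P A = 0 → MeasurableSet[𝓕 ⟨0, Set.mem_Iic.mpr bot_le⟩] A
  rightCont : ∀ s : Set.Iic T, (s : ℝ≥0) < T → (⨅ u : Set.Iic T, ⨅ _ : s < u, 𝓕 u) ≤ 𝓕 s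

/-- `W` is a standard `ℝ^d`-valued Brownian motion with respect to the filtration `𝓕` on
`[0, T]`: its coordinates are independent real Brownian motions, it is adapted, and its increments
are independent of the past. -/
structure IsBrownianMotion {Ω : Type*} {m : MeasurableSpace Ω} {d : ℕ} {T : ℝ≥0}
    (W : ℝ≥0 → Ω → Rd d) (𝓕 : Filtration (Set.Iic T) m) (P : Measure Ω) : Prop where
  coord : ∀ i : Fin d, IsBrownianReal (fun t ω => W t ω i) P
  indep_coord : iIndepFun (fun (i : Fin d) (ω : Ω) (t : ℝ≥0) => W t ω i) P
  adapted : ∀ t : Set.Iic T, Measurable[𝓕 t] (W t)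
  indep_incr : ∀ s t : Set.Iic T, s ≤ t →
    Indep (MeasurableSpace.comap (fun ω => W t ω - W s ω) inferInstance) (𝓕 s) P

/-- A deterministic step function `∑ᵢ 1_{(τᵢ, τᵢ₊₁]} Aᵢ` with `s ≤ τ₀ ≤ ⋯ ≤ τₙ ≤ t` and
`Aᵢ ∈ 𝓛(ℝ^d; G)`. -/
structure StepIntegrand (d : ℕ) (G : Type*) [NormedAddCommGroup G] [NormedSpace ℝ G]
    (s t : ℝ≥0) where
  n : ℕ
  τ : Fin (n + 1) → ℝ≥0
  mono : Monotone τ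
  mem : ∀ i, τ i ∈ Set.Icc s t
  val : Fin n → (Rd d →L[ℝ] G)

namespace StepIntegrand

variable {d : ℕ} {G : Type*} [NormedAddCommGroup G] [NormedSpace ℝ G] {s t : ℝ≥0}

/-- The step function itself. -/
def eval (S : StepIntegrand d G s t) (r : ℝ) : Rd d →L[ℝ] G :=
  ∑ i : Fin S.n,
    (Set.Ioc (S.τ i.castSucc : ℝ) (S.τ i.succ : ℝ)).indicator (fun _ => S.val i) r

/-- `∫_s^t S dW = ∑ᵢ Aᵢ (W_{τᵢ₊₁} - W_{τᵢ})`. -/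
def stochInt {Ω : Type*} (S : StepIntegrand d G s t) (W : ℝ≥0 → Ω → Rd d) (ω : Ω) : G :=
  ∑ i : Fin S.n, S.val i (W (S.τ i.succ) ω - W (S.τ i.castSucc) ω)

end StepIntegrand

/-- The square of the Hilbert–Schmidt norm of `A ∈ 𝓛(ℝ^d; G)`. -/
def hsNormSq {d : ℕ} {G : Type*} [NormedAddCommGroup G] [NormedSpace ℝ G]
    (A : Rd d →L[ℝ] G) : ℝ≥0∞ :=
  ∑ j : Fin d, ‖A (EuclideanSpace.single j (1 : ℝ))‖ₑ ^ 2

/-- `Y = ∫_s^t F(r) dW_r` (Itô integral of a deterministic square-integrable operator-valued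
integrand): `Y` is the `L²(Ω; G)`-limit of the integrals of step functions converging to `F` in
`L²(s, t; 𝓛_HS(ℝ^d; G))`. -/
def IsStochInt {Ω : Type*} {m : MeasurableSpace Ω} (P : Measure Ω) {d : ℕ}
    {G : Type*} [NormedAddCommGroup G] [NormedSpace ℝ G]
    (W : ℝ≥0 → Ω → Rd d) (F : ℝ → (Rd d →L[ℝ] G)) (s t : ℝ≥0) (Y : Ω → G) : Prop :=
  AEStronglyMeasurable F (volume.restrict (Set.Ioc (s : ℝ) t)) ∧
  MemLp Y 2 P ∧
  ∃ S : ℕ → StepIntegrand d G s t,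
    Tendsto (fun k => ∫⁻ r in Set.Ioc (s : ℝ) t, hsNormSq ((S k).eval r - F r)) atTop (𝓝 0) ∧
    Tendsto (fun k => eLpNorm (fun ω => (S k).stochInt W ω - Y ω) 2 P) atTop (𝓝 0)

/-! ### The equation -/

/-- `w ∈ ℋ^q` solves `w = φ + ∫_s^t B̄(r, w) dr + ∫_s^t σ(r) dW_r`, `P`-almost surely; the first
integral is a Bochner integral in `H`, with `B̄(r, w) = B̄(w)(r, ·)`. -/
def IsSolution {Ω : Type*} {m : MeasurableSpace Ω} {P : Measure Ω} {d : ℕ} {T q : ℝ≥0}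
    {α : ℝ} (hα : 1 / 2 < α) (W : ℝ≥0 → Ω → Rd d) (Bbar : HSpace d T → HSqSpace d T)
    (s t : ℝ≥0) (φ w : RandomH P d T q) : Prop :=
  ∃ Y : Ω → HSpace d T, IsStochInt P W (noiseCoeff d T hα) s t Y ∧
    ∀ᵐ ω ∂P,
      IntervalIntegrable (fun r => slice (Bbar (w ω)) r) volume s t ∧
      w ω = φ ω + (∫ r in (s : ℝ)..t, slice (Bbar (w ω)) r) + Y ω

end VolterraSDE

end

open VolterraSDE

/-! The noise is additive with a deterministic integrand, so `Y = ∫_s^t σ dW` is a random element of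
`H` that does not involve the unknown. Freezing `ω` leaves the deterministic equation `w = η + ∫_s^t
B̄(r, w) dr` with `η = φ(ω) + Y(ω)`. If its solution map `Θ` is Lipschitz (`exists_driftSolution`),
then `w = Θ(φ + Y)`: membership in `ℋ^q` follows from the linear growth of `Θ`, measurability from
its continuity, and uniqueness from pathwise uniqueness together with the almost sure uniqueness of
`Y`.

The drift is not a contraction on `H`, but it is triangular in time. On `(0, a)` the integral `∫_s^t
B̄(r, w) dr` only sees `r < a`, since `B̄(r, w)` vanishes before `r`; and for `r < a` the slice
`B̄(r, w)` depends only on `w` on `(0, a)`, with the same Lipschitz constant. On a fine partition of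
`[0, T]` the restricted norms, weighted by powers of two, are therefore halved by the drift
(`exists_lipschitz_fixedPoint`). Both structural properties are assumed for continuous paths and are
carried to `B̄` by density, using that `f ↦ f(r, ·)` is an isometry into `L²(0, T; H)`.

The integral `Y` is an `L²` limit of Riemann sums, by the Itô isometry and the continuity of `σ`.
Limits of Gaussian variables are Gaussian, which gives moments of every order.

For the cocycle property, drift and noise accumulated on `[u, t]` vanish on `(0, u)`. The final
solution thus agrees there with the intermediate one, causality identifies their drifts over `[s,
u]`, and adding the two equations gives the equation over `[s, t]` (`IsSolution.trans`). -/

noncomputable section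

namespace VolterraSDE

/-! ### Sections of square-integrable kernels as an isometry into `L²(0, T; H)`. -/

section Slice

/-- In a second-countable space every open set is a countable union of balls with centres in a dense
sequence, and the preimage of a ball is a sublevel set of a distance function. For an `L²`-valued
map this reduces measurability to Tonelli. -/
theorem measurable_of_measurable_edist {X E : Type*} [MeasurableSpace X] [PseudoEMetricSpace E]
    [SecondCountableTopology E] [MeasurableSpace E] [BorelSpace E] {f : X → E}
    (h : ∀ y, Measurable fun x => edist (f x) y) : Measurable f := by
  refine measurable_of_isOpen fun U hU => ?_
  obtain ⟨D, hDc, hD⟩ := TopologicalSpace.exists_countable_dense E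
  have key : U = ⋃ y ∈ D, ⋃ n : ℕ, ⋃ _ : Metric.eball y (n + 1 : ℝ≥0∞)⁻¹ ⊆ U,
      Metric.eball y (n + 1 : ℝ≥0∞)⁻¹ := by
    ext z
    simp only [Set.mem_iUnion, exists_prop]
    constructor
    · intro hz
      obtain ⟨ε, hε, hεU⟩ := EMetric.isOpen_iff.1 hU z hz
      obtain ⟨n, hn⟩ := ENNReal.exists_inv_nat_lt (ENNReal.half_pos hε.ne').ne'
      have hn' : (n + 1 : ℝ≥0∞)⁻¹ < ε / 2 :=
        lt_of_le_of_lt (ENNReal.inv_le_inv.2 le_self_add) hn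
      obtain ⟨y, hy, hyz⟩ := EMetric.mem_closure_iff.1 (hD z) (n + 1 : ℝ≥0∞)⁻¹ (by simp)
      refine ⟨y, hy, n, fun x hx => hεU ?_, hyz⟩
      calc edist x z ≤ edist x y + edist y z := edist_triangle _ _ _
        _ < ε / 2 + ε / 2 := ENNReal.add_lt_add (lt_trans hx hn')
            (by rw [edist_comm]; exact hyz.trans hn')
        _ = ε := ENNReal.add_halves ε
    · rintro ⟨y, -, n, hsub, hz⟩
      exact hsub hz
  rw [key, Set.preimage_iUnion₂]
  refine MeasurableSet.biUnion hDc fun y _ => ?_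
  simp only [Set.preimage_iUnion]
  refine MeasurableSet.iUnion fun n => MeasurableSet.iUnion fun _ => ?_
  exact measurableSet_lt (h y) measurable_const

instance fact_two_ne_top : Fact ((2 : ℝ≥0∞) ≠ ∞) := ⟨ENNReal.ofNat_ne_top⟩

variable {d : ℕ} {T : ℝ≥0}

theorem memLp_two_iff_lintegral_lt_top {X E : Type*} [MeasurableSpace X] {μ : Measure X}
    [NormedAddCommGroup E] {f : X → E} (hf : AEStronglyMeasurable f μ) :
    MemLp f 2 μ ↔ ∫⁻ x, ‖f x‖ₑ ^ 2 ∂μ < ∞ := by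
  rw [MemLp, and_iff_right hf, eLpNorm_lt_top_iff_lintegral_rpow_enorm_lt_top (by simp) (by simp)]
  simp

theorem eLpNorm_two_sq {X E : Type*} [MeasurableSpace X] (μ : Measure X)
    [NormedAddCommGroup E] (f : X → E) :
    eLpNorm f 2 μ ^ 2 = ∫⁻ x, ‖f x‖ₑ ^ 2 ∂μ := by
  have := eLpNorm_nnreal_pow_eq_lintegral (μ := μ) (f := f) (p := 2) (by simp)
  simpa using this

theorem enorm_sq_eq_lintegral {X E : Type*} [MeasurableSpace X] {μ : Measure X}
    [NormedAddCommGroup E] (f : Lp E 2 μ) :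
    ‖f‖ₑ ^ 2 = ∫⁻ x, ‖f x‖ₑ ^ 2 ∂μ := by
  rw [Lp.enorm_def, eLpNorm_two_sq]

/-- Tonelli; hence the default value `0` in `slice` occurs only on a null set. -/
theorem ae_memLp_section (f : HSqSpace d T) :
    ∀ᵐ r ∂(lebT T), MemLp (fun ξ : ℝ => f (r, ξ)) 2 (lebT T) := by
  have hf := Lp.stronglyMeasurable f
  have h1 := (memLp_two_iff_lintegral_lt_top (Lp.aestronglyMeasurable f)).1 (Lp.memLp f)
  rw [lintegral_prod _ (by fun_prop)] at h1
  have hm : Measurable fun r => ∫⁻ ξ, ‖f (r, ξ)‖ₑ ^ 2 ∂(lebT T) :=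
    Measurable.lintegral_prod_right' (f := fun p => ‖f p‖ₑ ^ 2) (by fun_prop)
  filter_upwards [ae_lt_top hm h1.ne] with r hr
  exact (memLp_two_iff_lintegral_lt_top
    (hf.comp_measurable measurable_prodMk_left).aestronglyMeasurable).2 hr

theorem slice_coeFn {f : HSqSpace d T} {r : ℝ}
    (h : MemLp (fun ξ : ℝ => f (r, ξ)) 2 (lebT T)) :
    slice f r =ᵐ[lebT T] fun ξ => f (r, ξ) := by
  rw [slice, dif_pos h]
  exact h.coeFn_toLp

theorem ae_slice_coeFn (f : HSqSpace d T) :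
    ∀ᵐ r ∂(lebT T), slice f r =ᵐ[lebT T] fun ξ => f (r, ξ) := by
  filter_upwards [ae_memLp_section f] with r hr using slice_coeFn hr

theorem slice_sub (f g : HSqSpace d T) :
    ∀ᵐ r ∂(lebT T), slice (f - g) r = slice f r - slice g r := by
  filter_upwards [ae_slice_coeFn (f - g), ae_slice_coeFn f, ae_slice_coeFn g,
    Measure.ae_ae_of_ae_prod (Lp.coeFn_sub f g)] with r h1 h2 h3 h4
  refine Lp.ext ?_
  filter_upwards [h1, h2, h3, h4, Lp.coeFn_sub (slice f r) (slice g r)] with ξ e1 e2 e3 e4 e5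
  rw [e1, e5, Pi.sub_apply, e2, e3, e4, Pi.sub_apply]

theorem stronglyMeasurable_slice (f : HSqSpace d T) : StronglyMeasurable (slice f) := by
  borelize (HSpace d T)
  refine Measurable.stronglyMeasurable (measurable_of_measurable_edist fun h => ?_)
  have hf := Lp.stronglyMeasurable f
  have hh := Lp.stronglyMeasurable h
  have hsec : ∀ r, StronglyMeasurable fun ξ => f (r, ξ) := fun r =>
    hf.comp_measurable measurable_prodMk_left
  have hs : MeasurableSet {r | MemLp (fun ξ : ℝ => f (r, ξ)) 2 (lebT T)} := by
    simp_rw [fun r => memLp_two_iff_lintegral_lt_top (hsec r).aestronglyMeasurable (μ := lebT T)]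
    refine measurableSet_lt ?_ measurable_const
    exact Measurable.lintegral_prod_right' (f := fun p => ‖f p‖ₑ ^ 2) (by fun_prop)
  classical
  have e : (fun r => edist (slice f r) h) = fun r =>
      if MemLp (fun ξ : ℝ => f (r, ξ)) 2 (lebT T) then
        (∫⁻ ξ, ‖f (r, ξ) - h ξ‖ₑ ^ 2 ∂(lebT T)) ^ (2⁻¹ : ℝ) else edist 0 h := by
    funext r
    split_ifs with hr
    · rw [edist_eq_enorm_sub]
      have h1 := enorm_sq_eq_lintegral (slice f r - h)
      have h2 : ∫⁻ ξ, ‖(slice f r - h) ξ‖ₑ ^ 2 ∂(lebT T)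
          = ∫⁻ ξ, ‖f (r, ξ) - h ξ‖ₑ ^ 2 ∂(lebT T) := by
        refine lintegral_congr_ae ?_
        filter_upwards [slice_coeFn hr, Lp.coeFn_sub (slice f r) h] with ξ e1 e2
        rw [e2, Pi.sub_apply, e1]
      rw [← h2, ← h1, ← ENNReal.rpow_natCast, ← ENNReal.rpow_mul]
      simp
    · rw [slice, dif_neg hr]
  rw [e]
  refine Measurable.ite hs ?_ measurable_const
  refine Measurable.pow_const ?_ _
  refine Measurable.lintegral_prod_right' (f := fun p : ℝ × ℝ => ‖f p - h p.2‖ₑ ^ 2) ?_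
  have : StronglyMeasurable fun p : ℝ × ℝ => f p - h p.2 :=
    hf.sub (hh.comp_measurable measurable_snd)
  fun_prop

/-- Tonelli again. With `slice_sub`, this makes `slice` an isometry from `L²((0, T)²)` to `L²(0, T;
H)`. -/
theorem lintegral_enorm_slice_sq (f : HSqSpace d T) :
    ∫⁻ r, ‖slice f r‖ₑ ^ 2 ∂(lebT T) = ‖f‖ₑ ^ 2 := by
  have hf := Lp.stronglyMeasurable f
  rw [enorm_sq_eq_lintegral, lintegral_prod _ (by fun_prop)]
  refine lintegral_congr_ae ?_
  filter_upwards [ae_slice_coeFn f] with r hr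
  rw [enorm_sq_eq_lintegral]
  refine lintegral_congr_ae ?_
  filter_upwards [hr] with ξ e
  rw [e]

theorem memLp_slice (f : HSqSpace d T) : MemLp (slice f) 2 (lebT T) := by
  rw [memLp_two_iff_lintegral_lt_top (stronglyMeasurable_slice f).aestronglyMeasurable,
    lintegral_enorm_slice_sq]
  simp

theorem eLpNorm_slice (f : HSqSpace d T) : eLpNorm (slice f) 2 (lebT T) = ‖f‖ₑ := by
  have h := (eLpNorm_two_sq (lebT T) (slice f)).trans (lintegral_enorm_slice_sq f)
  exact (ENNReal.pow_right_strictMono two_ne_zero).injective h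

theorem eLpNorm_slice_sub (f g : HSqSpace d T) :
    eLpNorm (fun r => slice f r - slice g r) 2 (lebT T) = ‖f - g‖ₑ := by
  rw [← eLpNorm_slice]
  exact eLpNorm_congr_ae ((slice_sub f g).mono fun r h => h.symm)

/-- By the isometry the slices converge in `L²(0, T; H)`, hence almost everywhere along a
subsequence. This is how properties holding for almost every `r` pass from `B` to `B̄`. -/
theorem exists_subseq_slice_tendsto {F : ℕ → HSqSpace d T} {f : HSqSpace d T}
    (h : Tendsto F atTop (𝓝 f)) :
    ∃ ns : ℕ → ℕ, StrictMono ns ∧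
      ∀ᵐ r ∂(lebT T), Tendsto (fun k => slice (F (ns k)) r) atTop (𝓝 (slice f r)) := by
  have h1 : Tendsto (fun n => eLpNorm (slice (F n) - slice f) 2 (lebT T)) atTop (𝓝 0) := by
    have : ∀ n, eLpNorm (slice (F n) - slice f) 2 (lebT T) = edist (F n) f := fun n => by
      rw [edist_eq_enorm_sub]
      exact eLpNorm_slice_sub (F n) f
    simp_rw [this]
    exact tendsto_iff_edist_tendsto_0.1 h
  exact (tendstoInMeasure_of_tendsto_eLpNorm (by simp)
    (fun n => (stronglyMeasurable_slice (F n)).aestronglyMeasurable)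
    (stronglyMeasurable_slice f).aestronglyMeasurable h1).exists_seq_tendsto_ae

end Slice

/-! ### Restriction to `(0, a)` and approximation by continuous paths. -/

section RestrictBelow

variable {d : ℕ} {T : ℝ≥0}

/-- Restriction of a function on `(0, T)` to `(0, a)`. -/
def restrictBelow (a : ℝ) :
    HSpace d T →L[ℝ] Lp (Rd d) 2 ((lebT T).restrict (Set.Iio a)) :=
  LpToLpRestrictCLM ℝ (Rd d) ℝ (lebT T) 2 (Set.Iio a)

theorem restrictBelow_coeFn (a : ℝ) (h : HSpace d T) :
    restrictBelow a h =ᵐ[(lebT T).restrict (Set.Iio a)] h :=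
  LpToLpRestrictCLM_coeFn ℝ _ h

theorem enorm_restrictBelow (a : ℝ) (h : HSpace d T) :
    ‖restrictBelow a h‖ₑ = eLpNorm h 2 ((lebT T).restrict (Set.Iio a)) := by
  rw [Lp.enorm_def]
  exact eLpNorm_congr_ae (restrictBelow_coeFn a h)

theorem norm_restrictBelow_mono {a b : ℝ} (hab : a ≤ b) (h : HSpace d T) :
    ‖restrictBelow a h‖ ≤ ‖restrictBelow b h‖ := by
  rw [← enorm_le_iff_norm_le, enorm_restrictBelow, enorm_restrictBelow]
  exact eLpNorm_mono_measure _ (Measure.restrict_mono (Set.Iio_subset_Iio hab) le_rfl)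

theorem norm_restrictBelow_le (a : ℝ) (h : HSpace d T) : ‖restrictBelow a h‖ ≤ ‖h‖ := by
  rw [← enorm_le_iff_norm_le, enorm_restrictBelow, Lp.enorm_def]
  exact eLpNorm_mono_measure _ Measure.restrict_le_self

theorem norm_restrictBelow_of_le {a : ℝ} (ha : T ≤ a) (h : HSpace d T) :
    ‖restrictBelow a h‖ = ‖h‖ := by
  refine le_antisymm (norm_restrictBelow_le a h) ?_
  rw [← enorm_le_iff_norm_le, enorm_restrictBelow, Lp.enorm_def, Measure.restrict_restrict
    measurableSet_Iio, Set.inter_eq_right.2 fun x hx => hx.2.trans_le ha]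

theorem restrictBelow_eq_zero_iff {a : ℝ} {h : HSpace d T} :
    restrictBelow a h = 0 ↔ ∀ᵐ ξ ∂(lebT T), ξ < a → h ξ = 0 := by
  have e : (∀ᵐ ξ ∂(lebT T), ξ < a → h ξ = 0) ↔ ∀ᵐ ξ ∂((lebT T).restrict (Set.Iio a)), h ξ = 0 :=
    (ae_restrict_iff' measurableSet_Iio).symm
  rw [e, Lp.eq_zero_iff_ae_eq_zero]
  have := restrictBelow_coeFn a h
  constructor
  · intro H
    filter_upwards [H, this] with ξ h1 h2
    rw [← h2, h1]; rfl
  · intro H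
    filter_upwards [H, this] with ξ h1 h2
    rw [h2, h1]; rfl

theorem restrictBelow_eq_zero_mono {a b : ℝ} (hab : a ≤ b) {h : HSpace d T}
    (hb : restrictBelow b h = 0) : restrictBelow a h = 0 := by
  rw [← norm_le_zero_iff]
  simpa [hb] using norm_restrictBelow_mono hab h

/-- Every `h ∈ H` can be cut off after time `a`. -/
theorem exists_cutoff (a : ℝ) (h : HSpace d T) :
    ∃ g : HSpace d T, ‖g‖ = ‖restrictBelow a h‖ ∧ restrictBelow a (h - g) = 0 ∧
      g =ᵐ[lebT T] (Set.Iio a).indicator h := by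
  have hm : MemLp ((Set.Iio a).indicator h) 2 (lebT T) := (Lp.memLp h).indicator measurableSet_Iio
  refine ⟨hm.toLp _, ?_, ?_, hm.coeFn_toLp⟩
  · rw [← toReal_enorm, ← toReal_enorm, enorm_restrictBelow, Lp.enorm_def,
      eLpNorm_congr_ae hm.coeFn_toLp, eLpNorm_indicator_eq_eLpNorm_restrict measurableSet_Iio]
  · rw [restrictBelow_eq_zero_iff]
    filter_upwards [hm.coeFn_toLp, Lp.coeFn_sub h (hm.toLp _)] with ξ h1 h2 h3
    rw [h2, Pi.sub_apply, h1, Set.indicator_of_mem (Set.mem_Iio.2 h3), sub_self]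

theorem PathSpace.toH_coeFn (w : PathSpace d T) :
    ∀ᵐ ξ ∂(lebT T), ∀ h : ξ ∈ Set.Icc (0 : ℝ) T, w.toH ξ = w ⟨ξ, h⟩ := by
  filter_upwards [w.memLp.coeFn_toLp] with ξ h1 h
  refine h1.trans ?_
  simp [Set.projIcc_of_mem T.coe_nonneg h]

theorem PathSpace.toH_add (w₁ w₂ : PathSpace d T) : (w₁ + w₂).toH = w₁.toH + w₂.toH := by
  refine Lp.ext ?_
  filter_upwards [w₁.memLp.coeFn_toLp, w₂.memLp.coeFn_toLp, (w₁ + w₂).memLp.coeFn_toLp,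
    Lp.coeFn_add w₁.toH w₂.toH] with ξ h1 h2 h3 h4
  rw [h4, Pi.add_apply]
  refine h3.trans ?_
  rw [ContinuousMap.add_apply]
  exact congrArg₂ (· + ·) h1.symm h2.symm

/-- A ramp, equal to `0` before `a` and to `1` after `a + 1 / n`. -/
def ramp (a : ℝ) (n : ℕ) (x : ℝ) : ℝ := min 1 (max 0 (n * (x - a)))

theorem continuous_ramp (a : ℝ) (n : ℕ) : Continuous (ramp a n) := by
  unfold ramp; fun_prop

theorem ramp_of_le {a x : ℝ} (n : ℕ) (h : x ≤ a) : ramp a n x = 0 := by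
  have : (n : ℝ) * (x - a) ≤ 0 := mul_nonpos_of_nonneg_of_nonpos n.cast_nonneg (by linarith)
  simp [ramp, max_eq_left this]

theorem ramp_mem (a : ℝ) (n : ℕ) (x : ℝ) : ramp a n x ∈ Set.Icc (0 : ℝ) 1 :=
  ⟨le_min zero_le_one (le_max_left _ _), min_le_left _ _⟩

theorem tendsto_ramp {a x : ℝ} (h : a < x) :
    Tendsto (fun n => ramp a n x) atTop (𝓝 1) := by
  refine tendsto_const_nhds.congr' ?_
  have h1 : Tendsto (fun n : ℕ => (n : ℝ) * (x - a)) atTop atTop :=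
    tendsto_natCast_atTop_atTop.atTop_mul_const (sub_pos.2 h)
  filter_upwards [h1.eventually_ge_atTop 1] with n hn
  rw [ramp, max_eq_right (zero_le_one.trans hn), min_eq_left hn]

/-- Continuous paths vanishing before `a` are dense in the elements of `H` vanishing
before `a`. -/
theorem exists_seq_path_tendsto_of_restrictBelow_eq_zero {a : ℝ} {v : HSpace d T}
    (hv : restrictBelow a v = 0) :
    ∃ c : ℕ → PathSpace d T, (∀ n (x : Set.Icc (0 : ℝ) T), (x : ℝ) < a → c n x = 0) ∧
      Tendsto (fun n => (c n).toH) atTop (𝓝 v) := by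
  set S : Set (HSpace d T) := PathSpace.toH '' {c | ∀ x : Set.Icc (0 : ℝ) T, (x : ℝ) < a → c x = 0}
  suffices hS : v ∈ closure S by
    obtain ⟨u, hu, hlim⟩ := mem_closure_iff_seq_limit.1 hS
    choose c hc hcu using hu
    exact ⟨c, hc, by simpa [hcu] using hlim⟩
  -- Ramps times `g` converge to `1_{(a, ∞)} g`. As `v` vanishes before `a`, this cut-off is no
  -- further from `v` than `g` is, so density of all paths suffices.
  have hcut : ∀ g : PathSpace d T, ∃ y ∈ closure S, ‖y - v‖ ≤ ‖g.toH - v‖ := by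
    intro g
    set c : ℕ → PathSpace d T := fun n =>
      ⟨fun x => ramp a n x • g x, by have := continuous_ramp a n; fun_prop⟩
    have hm : MemLp ((Set.Ioi a).indicator g.toH) 2 (lebT T) :=
      (Lp.memLp g.toH).indicator measurableSet_Ioi
    refine ⟨hm.toLp _, ?_, ?_⟩
    · refine mem_closure_of_tendsto (f := fun n => (c n).toH) (b := atTop) ?_
        (Eventually.of_forall fun n => ⟨c n, fun x hx => ?_, rfl⟩)
      · rw [tendsto_iff_edist_tendsto_0]
        have hpow : Tendsto (fun n => edist (c n).toH (hm.toLp _) ^ 2) atTop (𝓝 (0 ^ 2)) := by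
          have e : ∀ n, edist (c n).toH (hm.toLp _) ^ 2 =
              ∫⁻ ξ, ‖(c n).toH ξ - (Set.Ioi a).indicator g.toH ξ‖ₑ ^ 2 ∂(lebT T) := by
            intro n
            rw [edist_eq_enorm_sub, enorm_sq_eq_lintegral]
            refine lintegral_congr_ae ?_
            filter_upwards [Lp.coeFn_sub (c n).toH (hm.toLp _), hm.coeFn_toLp] with ξ h1 h2
            rw [h1, Pi.sub_apply, h2]
          simp_rw [e]
          have hz : (0 : ℝ≥0∞) ^ 2 = ∫⁻ _, 0 ∂(lebT T) := by simp
          rw [hz]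
          refine tendsto_lintegral_of_dominated_convergence' (fun ξ => ‖g.toH ξ‖ₑ ^ 2) ?_ ?_ ?_ ?_
          · intro n
            exact ((Lp.aestronglyMeasurable _).sub hm.1).enorm.pow_const 2
          · intro n
            filter_upwards [(c n).toH_coeFn, g.toH_coeFn, ae_restrict_mem measurableSet_Ioo]
              with ξ h1 h2 h3
            have h4 := Set.Ioo_subset_Icc_self h3
            rw [h1 h4, h2 h4]
            gcongr
            rw [enorm_le_iff_norm_le]
            have hr := ramp_mem a n ξ
            change ‖ramp a n ξ • g ⟨ξ, h4⟩ - _‖ ≤ _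
            by_cases hξ : a < ξ
            · rw [Set.indicator_of_mem (Set.mem_Ioi.2 hξ), h2 h4, ← neg_sub, norm_neg]
              have : g ⟨ξ, h4⟩ - ramp a n ξ • g ⟨ξ, h4⟩ = (1 - ramp a n ξ) • g ⟨ξ, h4⟩ := by
                rw [sub_smul, one_smul]
              rw [this, norm_smul, Real.norm_of_nonneg (by linarith [hr.2])]
              exact mul_le_of_le_one_left (norm_nonneg _) (by linarith [hr.1])
            · rw [Set.indicator_of_notMem (by simpa using hξ), ramp_of_le n (not_lt.1 hξ)]
              simp
          · rw [← enorm_sq_eq_lintegral]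
            simp
          · have hall : ∀ᵐ ξ ∂(lebT T), ∀ n, ∀ h : ξ ∈ Set.Icc (0 : ℝ) T,
                (c n).toH ξ = c n ⟨ξ, h⟩ := ae_all_iff.2 fun n => (c n).toH_coeFn
            filter_upwards [hall, g.toH_coeFn, ae_restrict_mem measurableSet_Ioo] with ξ h1 h2 h3
            have h4 := Set.Ioo_subset_Icc_self h3
            have h5 : ∀ n, (c n).toH ξ = ramp a n ξ • g ⟨ξ, h4⟩ := fun n => h1 n h4
            simp_rw [h5]
            by_cases hξ : a < ξ
            · rw [Set.indicator_of_mem (Set.mem_Ioi.2 hξ), h2 h4]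
              have := (((tendsto_ramp hξ).smul_const (g ⟨ξ, h4⟩)).sub_const (g ⟨ξ, h4⟩)).enorm
              simpa using ENNReal.Tendsto.pow (n := 2) this
            · rw [Set.indicator_of_notMem (by simpa using hξ)]
              simp [ramp_of_le _ (not_lt.1 hξ)]
        have := (ENNReal.continuous_rpow_const (y := (2⁻¹ : ℝ))).tendsto _ |>.comp hpow
        refine (this.congr fun n => ?_).trans (by simp)
        simp only [Function.comp_apply]
        rw [← ENNReal.rpow_natCast, ← ENNReal.rpow_mul]
        simp
      · change ramp a n (x : ℝ) • g x = 0
        rw [ramp_of_le n hx.le, zero_smul]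
    · refine Lp.norm_le_norm_of_ae_le ?_
      filter_upwards [Lp.coeFn_sub (hm.toLp _) v, Lp.coeFn_sub g.toH v, hm.coeFn_toLp,
        restrictBelow_eq_zero_iff.1 hv, Measure.ae_ne (lebT T) a] with ξ h1 h2 h3 h4 h5
      rw [h1, h2, Pi.sub_apply, Pi.sub_apply, h3]
      rcases lt_or_gt_of_ne h5 with hξ | hξ
      · rw [Set.indicator_of_notMem (by simpa using hξ.le), h4 hξ]
        simp
      · rw [Set.indicator_of_mem (Set.mem_Ioi.2 hξ)]
  rw [← closure_closure, Metric.mem_closure_iff]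
  intro ε hε
  obtain ⟨_, ⟨g, rfl⟩, hg⟩ := Metric.mem_closure_iff.1 (PathSpace.denseRange_toH d T v) ε hε
  obtain ⟨y, hy, hyv⟩ := hcut g
  refine ⟨y, hy, ?_⟩
  rw [dist_comm, dist_eq_norm] at hg ⊢
  exact hyv.trans_lt hg

end RestrictBelow

/-! ### An abstract fixed point theorem with weighted seminorms. -/

section FixedPoint

/-- A map which halves a geometrically weighted finite family of seminorms has, after adding a
constant `η`, exactly one fixed point, which depends on `η` in a Lipschitz way. -/
theorem exists_lipschitz_fixedPoint {E : Type*} [NormedAddCommGroup E] [CompleteSpace E]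
    (G : E → E) (N : ℕ) (p : ℕ → E → ℝ) (hpN : ∀ x, p N x = ‖x‖)
    (hple : ∀ k x, p k x ≤ ‖x‖) (hadd : ∀ k x y, p k (x + y) ≤ p k x + p k y)
    (hG : ∀ (w₁ w₂ : E) (M : ℝ), 0 ≤ M → (∀ k ≤ N, p k (w₁ - w₂) ≤ 2 ^ k * M) →
      ∀ k ≤ N, p k (G w₁ - G w₂) ≤ 2 ^ k * (M / 2)) :
    ∃ Θ : E → E, (∀ η, Θ η = η + G (Θ η)) ∧ (∀ η w, w = η + G w → w = Θ η) ∧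
      ∃ L, LipschitzWith L Θ := by
  have hstart : ∀ x : E, ∀ k ≤ N, p k x ≤ 2 ^ k * ‖x‖ := fun x k _ =>
    (hple k x).trans (le_mul_of_one_le_left (norm_nonneg _) (one_le_pow₀ one_le_two))
  have hiter : ∀ (η w₁ w₂ : E) (m : ℕ), ∀ k ≤ N,
      p k ((fun w => η + G w)^[m] w₁ - (fun w => η + G w)^[m] w₂)
        ≤ 2 ^ k * (‖w₁ - w₂‖ / 2 ^ m) := by
    intro η w₁ w₂ m
    induction m with
    | zero => simpa using hstart (w₁ - w₂)
    | succ m ih =>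
      intro k hk
      have := hG _ _ _ (by positivity) ih k hk
      simp only [Function.iterate_succ_apply', add_sub_add_left_eq_sub]
      refine this.trans (le_of_eq ?_)
      rw [pow_succ]
      ring
  -- Reading off the norm from the weighted bounds at `k = N` costs a factor `2 ^ N`; `N + 1`
  -- halvings absorb it and leave `1 / 2`.
  have hcontr : ∀ η, ContractingWith (1 / 2) (fun w => η + G w)^[N + 1] := by
    intro η
    refine ⟨by rw [← NNReal.coe_lt_coe]; norm_num, LipschitzWith.of_dist_le_mul fun x y => ?_⟩
    rw [dist_eq_norm, dist_eq_norm, ← hpN]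
    refine (hiter η x y (N + 1) N le_rfl).trans (le_of_eq ?_)
    push_cast
    rw [pow_succ]
    field_simp
  refine ⟨fun η => (hcontr η).fixedPoint _, fun η => ?_, fun η w hw => ?_, ?_⟩
  · exact ((hcontr η).isFixedPt_fixedPoint_iterate).symm
  · refine (hcontr η).fixedPoint_unique ?_
    exact Function.IsFixedPt.iterate (f := fun w => η + G w) hw.symm _
  · refine ⟨2 ^ (N + 1), LipschitzWith.of_dist_le_mul fun η₁ η₂ => ?_⟩
    set w₁ := (hcontr η₁).fixedPoint _
    set w₂ := (hcontr η₂).fixedPoint _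
    have e₁ : η₁ + G w₁ = w₁ := (hcontr η₁).isFixedPt_fixedPoint_iterate
    have e₂ : η₂ + G w₂ = w₂ := (hcontr η₂).isFixedPt_fixedPoint_iterate
    -- One use of the equation turns a weighted bound `M` into `‖η₁ - η₂‖ + M / 2`. The fixed point
    -- of this recursion is `2 * ‖η₁ - η₂‖`, and the excess over it halves each time.
    have hb : ∀ m : ℕ, ∀ k ≤ N,
        p k (w₁ - w₂) ≤ 2 ^ k * (2 * ‖η₁ - η₂‖ + ‖w₁ - w₂‖ / 2 ^ m) := by
      intro m
      induction m with
      | zero =>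
        intro k hk
        refine (hstart _ k hk).trans ?_
        gcongr
        simp
      | succ m ih =>
        intro k hk
        have e : w₁ - w₂ = (η₁ - η₂) + (G w₁ - G w₂) := by
          nth_rewrite 1 [← e₁, ← e₂]
          abel
        calc p k (w₁ - w₂) ≤ p k (η₁ - η₂) + p k (G w₁ - G w₂) := by
              rw [e]; exact hadd _ _ _
          _ ≤ 2 ^ k * ‖η₁ - η₂‖ + 2 ^ k * ((2 * ‖η₁ - η₂‖ + ‖w₁ - w₂‖ / 2 ^ m) / 2) :=
              add_le_add (hstart _ k hk) (hG _ _ _ (by positivity) ih k hk)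
          _ = _ := by rw [pow_succ]; ring
    have hlim : Tendsto (fun m : ℕ => 2 ^ N * (2 * ‖η₁ - η₂‖ + ‖w₁ - w₂‖ / 2 ^ m)) atTop
        (𝓝 (2 ^ N * (2 * ‖η₁ - η₂‖ + 0))) := by
      refine Tendsto.const_mul _ (Tendsto.const_add _ ?_)
      exact tendsto_const_nhds.div_atTop (tendsto_pow_atTop_atTop_of_one_lt one_lt_two)
    have := ge_of_tendsto' hlim fun m => hb m N le_rfl
    rw [hpN] at this
    rw [dist_eq_norm, dist_eq_norm]
    refine this.trans (le_of_eq ?_)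
    push_cast
    ring

end FixedPoint

/-! ### Structure of the extended drift and the deterministic equation. -/

section Drift

variable {d : ℕ} {T : ℝ≥0}

theorem driftExtension_lipschitz {B : PathSpace d T → HSqSpace d T} (hB : DriftAssumption B) :
    ∃ C : ℝ≥0, LipschitzWith C (driftExtension hB) := by
  obtain ⟨C, hC, -, hL⟩ := hB.bound
  obtain ⟨hcont, hext⟩ := driftExtension_spec hB
  refine ⟨⟨C, hC.le⟩, LipschitzWith.of_dist_le_mul fun w₁ w₂ => ?_⟩
  refine (PathSpace.denseRange_toH d T).induction_on₂ (p := fun w₁ w₂ =>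
    dist (driftExtension hB w₁) (driftExtension hB w₂) ≤ C * dist w₁ w₂) ?_ ?_ w₁ w₂
  · exact isClosed_le (by fun_prop) (by fun_prop)
  · intro u v
    rw [hext, hext, dist_eq_norm, dist_eq_norm]
    exact hL u v

/-- For continuous paths this is the Volterra hypothesis at time `T`. It survives the limit because,
for almost every `r`, the slices converge along a subsequence and `restrictBelow r` is continuous.
-/
theorem slice_driftExtension_volterra {B : PathSpace d T → HSqSpace d T}
    (hB : DriftAssumption B) (w : HSpace d T) :
    ∀ᵐ r ∂(lebT T), restrictBelow r (slice (driftExtension hB w) r) = 0 := by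
  obtain ⟨hcont, hext⟩ := driftExtension_spec hB
  rcases eq_zero_or_pos T with hT | hT
  · simp [lebT, hT]
  obtain ⟨u, hu, hlim⟩ := mem_closure_iff_seq_limit.1 (PathSpace.denseRange_toH d T w)
  choose c hc using hu
  obtain ⟨ns, -, hns⟩ := exists_subseq_slice_tendsto ((hcont.tendsto w).comp hlim)
  have hall : ∀ᵐ r ∂(lebT T), ∀ n, restrictBelow r (slice (driftExtension hB (u n)) r) = 0 := by
    refine ae_all_iff.2 fun n => ?_
    filter_upwards [hB.volterra (c n) T (by exact_mod_cast hT) le_rfl,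
      ae_slice_coeFn (B (c n))] with r h1 h2
    rw [← hc n, hext, restrictBelow_eq_zero_iff]
    rw [ae_restrict_iff' measurableSet_Ioo] at h1
    filter_upwards [h2, ae_restrict_mem measurableSet_Ioo, ae_restrict_of_ae h1] with ξ e1 e2 e3 e4
    rw [e1, e3 ⟨e2.1, e4⟩]
  filter_upwards [hns, hall] with r h1 h2
  have h3 := ((restrictBelow r).continuous.tendsto _).comp h1
  refine tendsto_nhds_unique h3 (tendsto_const_nhds.congr fun k => ?_)
  exact (h2 _).symm

/-- Independent approximations of `w₁` and `w₂` need not agree before `a`. Instead `w₂` is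
approximated by paths `g n` and the difference `w₁ - w₂` by paths `c n` vanishing before `a`, so
that causality applies to `g n + c n` and `g n`. -/
theorem slice_driftExtension_causal {B : PathSpace d T → HSqSpace d T}
    (hB : DriftAssumption B) {a : ℝ} (ha : 0 < a) (haT : a ≤ T) {w₁ w₂ : HSpace d T}
    (h : restrictBelow a (w₁ - w₂) = 0) :
    ∀ᵐ r ∂(lebT T), r < a →
      slice (driftExtension hB w₁) r = slice (driftExtension hB w₂) r := by
  obtain ⟨hcont, hext⟩ := driftExtension_spec hB
  obtain ⟨u, hu, hlim⟩ := mem_closure_iff_seq_limit.1 (PathSpace.denseRange_toH d T w₂)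
  choose g hg using hu
  obtain ⟨c, hc0, hc⟩ := exists_seq_path_tendsto_of_restrictBelow_eq_zero h
  have hl2 : Tendsto (fun n => (g n).toH) atTop (𝓝 w₂) := by simpa [hg] using hlim
  have hl1 : Tendsto (fun n => (g n + c n).toH) atTop (𝓝 w₁) := by
    simpa [PathSpace.toH_add] using hl2.add hc
  obtain ⟨ns, hmono, hns⟩ := exists_subseq_slice_tendsto ((hcont.tendsto w₁).comp hl1)
  obtain ⟨ms, hmono', hms⟩ := exists_subseq_slice_tendsto
    (((hcont.tendsto w₂).comp hl2).comp hmono.tendsto_atTop)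
  have hall : ∀ᵐ r ∂(lebT T), ∀ n, r < a →
      slice (driftExtension hB (g n + c n).toH) r = slice (driftExtension hB (g n).toH) r := by
    refine ae_all_iff.2 fun n => ?_
    have hca := hB.causal (g n + c n) (g n) a ha haT fun x hx => by
      rw [ContinuousMap.add_apply, hc0 n x hx.2, add_zero]
    rw [ae_restrict_iff' measurableSet_Ioo] at hca
    filter_upwards [ae_restrict_of_ae hca, ae_restrict_mem measurableSet_Ioo,
      ae_slice_coeFn (B (g n + c n)), ae_slice_coeFn (B (g n))] with r h1 h2 h3 h4 h5
    rw [hext, hext]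
    refine Lp.ext ?_
    filter_upwards [h1 ⟨h2.1, h5⟩, h3, h4] with ξ e1 e2 e3
    rw [e2, e3, e1]
  filter_upwards [hns, hms, hall] with r h1 h2 h3 h4
  have h5 := h1.comp hmono'.tendsto_atTop
  exact tendsto_nhds_unique h5 (h2.congr fun k => (h3 _ h4).symm)

/-- Let `g` be `w₁ - w₂` cut off after `a`. Then `w₁ - g` agrees with `w₂` before `a`, so by
causality it has the same drift there, and the global Lipschitz bound for `w₁` and `w₁ - g` involves
only `‖g‖`. -/
theorem eLpNorm_slice_driftExtension_sub_le {B : PathSpace d T → HSqSpace d T}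
    (hB : DriftAssumption B) {C : ℝ≥0} (hC : LipschitzWith C (driftExtension hB))
    {a : ℝ} (ha : 0 < a) (haT : a ≤ T) (w₁ w₂ : HSpace d T) :
    eLpNorm (fun r => slice (driftExtension hB w₁) r - slice (driftExtension hB w₂) r) 2
      ((lebT T).restrict (Set.Iio a)) ≤ C * ‖restrictBelow a (w₁ - w₂)‖ₑ := by
  obtain ⟨g, hg1, hg2, -⟩ := exists_cutoff a (w₁ - w₂)
  have hca := slice_driftExtension_causal hB ha haT (w₁ := w₁ - g) (w₂ := w₂)
    (by rwa [sub_right_comm])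
  calc _ = eLpNorm (fun r => slice (driftExtension hB w₁) r - slice (driftExtension hB (w₁ - g)) r)
          2 ((lebT T).restrict (Set.Iio a)) := by
        refine eLpNorm_congr_ae ?_
        filter_upwards [ae_restrict_of_ae hca, ae_restrict_mem measurableSet_Iio] with r h1 h2
        rw [h1 h2]
    _ ≤ eLpNorm (fun r => slice (driftExtension hB w₁) r - slice (driftExtension hB (w₁ - g)) r)
          2 (lebT T) := eLpNorm_mono_measure _ Measure.restrict_le_self
    _ = edist (driftExtension hB w₁) (driftExtension hB (w₁ - g)) := by
        rw [eLpNorm_slice_sub, edist_eq_enorm_sub]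
    _ ≤ C * edist w₁ (w₁ - g) := hC w₁ (w₁ - g)
    _ = C * ‖restrictBelow a (w₁ - w₂)‖ₑ := by
        rw [edist_eq_enorm_sub, sub_sub_cancel]
        congr 1
        rw [← ofReal_norm, ← ofReal_norm, hg1]

theorem intervalIntegrable_slice (f : HSqSpace d T) {s t : ℝ} (hs : 0 ≤ s) (hst : s ≤ t)
    (ht : t ≤ T) : IntervalIntegrable (slice f) volume s t := by
  rw [intervalIntegrable_iff, Set.uIoc_of_le hst, integrableOn_Ioc_iff_integrableOn_Ioo]
  exact (memLp_slice f).integrable one_le_two |>.mono_measure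
    (Measure.restrict_mono (Set.Ioo_subset_Ioo hs ht) le_rfl)

/-- A Cauchy–Schwarz estimate for one time step. -/
theorem lintegral_Iio_enorm_le {b : ℝ → HSpace d T} (hb : AEStronglyMeasurable b (lebT T))
    {a a' : ℝ} :
    ∫⁻ r in Set.Iio a', ‖b r‖ₑ ∂(lebT T) ≤ ∫⁻ r in Set.Iio a, ‖b r‖ₑ ∂(lebT T) +
      eLpNorm b 2 ((lebT T).restrict (Set.Iio a')) * ENNReal.ofReal (a' - a) ^ (1 / 2 : ℝ) := by
  have hsub : Set.Iio a' ⊆ Set.Iio a ∪ Set.Ico a a' := fun x hx => by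
    rcases lt_or_ge x a with h | h
    exacts [Or.inl h, Or.inr ⟨h, hx⟩]
  refine (lintegral_mono_set hsub).trans ((lintegral_union_le _ _ _).trans ?_)
  gcongr
  rw [← eLpNorm_one_eq_lintegral_enorm]
  refine (eLpNorm_le_eLpNorm_mul_rpow_measure_univ one_le_two hb.restrict).trans ?_
  have h1 : eLpNorm b 2 ((lebT T).restrict (Set.Ico a a')) ≤
      eLpNorm b 2 ((lebT T).restrict (Set.Iio a')) :=
    eLpNorm_mono_measure _ (Measure.restrict_mono (fun x hx => hx.2) le_rfl)
  have h2 : (lebT T).restrict (Set.Ico a a') Set.univ ≤ ENNReal.ofReal (a' - a) := by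
    rw [Measure.restrict_apply_univ, ← Real.volume_Ico]
    exact Measure.restrict_apply_le _ _
  have h3 : 1 / (1 : ℝ≥0∞).toReal - 1 / (2 : ℝ≥0∞).toReal = 1 / 2 := by norm_num
  rw [h3]
  gcongr

/-- The drift operator `w ↦ ∫_s^t B̄(r, w) dr`. -/
def driftIntegral (f : HSpace d T → HSqSpace d T) (s t : ℝ) (w : HSpace d T) : HSpace d T :=
  ∫ r in s..t, slice (f w) r

/-- Slices at times `r ≥ a` vanish before `r`, hence before `a`, and contribute nothing. -/
theorem enorm_restrictBelow_driftIntegral_sub_le {B : PathSpace d T → HSqSpace d T}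
    (hB : DriftAssumption B) {s t : ℝ} (hs : 0 ≤ s) (hst : s ≤ t) (ht : t ≤ T)
    (a : ℝ) (w₁ w₂ : HSpace d T) :
    ‖restrictBelow a (driftIntegral (driftExtension hB) s t w₁ -
        driftIntegral (driftExtension hB) s t w₂)‖ₑ ≤
      ∫⁻ r in Set.Iio a, ‖slice (driftExtension hB w₁) r - slice (driftExtension hB w₂) r‖ₑ
        ∂(lebT T) := by
  have h1 := intervalIntegrable_slice (driftExtension hB w₁) hs hst ht
  have h2 := intervalIntegrable_slice (driftExtension hB w₂) hs hst ht
  rw [driftIntegral, driftIntegral, ← intervalIntegral.integral_sub h1 h2,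
    ← ContinuousLinearMap.intervalIntegral_comp_comm _ (h1.sub h2),
    intervalIntegral.integral_of_le hst, integral_Ioc_eq_integral_Ioo]
  refine (enorm_integral_le_lintegral_enorm _).trans ?_
  have hle : volume.restrict (Set.Ioo s t) ≤ lebT T :=
    Measure.restrict_mono (Set.Ioo_subset_Ioo hs ht) le_rfl
  refine (lintegral_mono' hle le_rfl).trans ?_
  rw [← lintegral_indicator measurableSet_Iio]
  refine lintegral_mono_ae ?_
  filter_upwards [slice_driftExtension_volterra hB w₁, slice_driftExtension_volterra hB w₂]
    with r e1 e2
  by_cases hr : r < a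
  · rw [Set.indicator_of_mem (Set.mem_Iio.2 hr), enorm_le_iff_norm_le]
    exact norm_restrictBelow_le _ _
  · have : restrictBelow a (slice (driftExtension hB w₁) r - slice (driftExtension hB w₂) r) = 0 :=
      restrictBelow_eq_zero_mono (not_lt.1 hr) (by rw [map_sub, e1, e2, sub_zero])
    simp [this]

/-- The deterministic equation `w = η + ∫_s^t B̄(r, w) dr` is uniquely solvable, and its solution
depends on `η` in a Lipschitz way. -/
theorem exists_driftSolution {B : PathSpace d T → HSqSpace d T} (hB : DriftAssumption B)
    (hT : 0 < T) {s t : ℝ} (hs : 0 ≤ s) (hst : s ≤ t) (ht : t ≤ T) :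
    ∃ Θ : HSpace d T → HSpace d T,
      (∀ η, Θ η = η + driftIntegral (driftExtension hB) s t (Θ η)) ∧
      (∀ η w, w = η + driftIntegral (driftExtension hB) s t w → w = Θ η) ∧
      ∃ L, LipschitzWith L Θ := by
  obtain ⟨C, hC⟩ := driftExtension_lipschitz hB
  -- The condition `16 C² T ≤ N` amounts to `C √(T / N) ≤ 1 / 4`, the smallness needed on one time
  -- step; `N = n + 1` is moreover positive.
  obtain ⟨n, hn⟩ := exists_nat_ge (16 * (C : ℝ) ^ 2 * T)
  set N := n + 1
  have hT' : (0 : ℝ) < T := by exact_mod_cast hT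
  have hN : (0 : ℝ) < N := by positivity
  have hδ : (C : ℝ) * √(T / N) ≤ 1 / 4 := by
    have h1 : (C : ℝ) * √(T / N) = √((C : ℝ) ^ 2 * (T / N)) := by
      rw [Real.sqrt_mul (by positivity), Real.sqrt_sq C.coe_nonneg]
    rw [h1, Real.sqrt_le_left (by norm_num), ← mul_div_assoc, div_le_iff₀ hN]
    have : (N : ℝ) = n + 1 := by push_cast [N]; ring
    rw [this]
    linarith
  refine exists_lipschitz_fixedPoint _ N (fun k x => ‖restrictBelow (k * (T / N) : ℝ) x‖)
    (fun x => ?_) (fun k x => norm_restrictBelow_le _ x)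
    (fun k x y => by rw [map_add]; exact norm_add_le _ _) ?_
  · refine norm_restrictBelow_of_le (le_of_eq ?_) x
    field_simp
  intro w₁ w₂ M hM hle
  set b : ℝ → HSpace d T := fun r =>
    slice (driftExtension hB w₁) r - slice (driftExtension hB w₂) r with hb
  have hbm : AEStronglyMeasurable b (lebT T) :=
    ((stronglyMeasurable_slice _).sub (stronglyMeasurable_slice _)).aestronglyMeasurable
  -- The earlier steps contribute `2 ^ k * (M / 2)` by induction. By Cauchy–Schwarz the new one
  -- contributes at most `C √(T / N) * 2 ^ (k + 1) * M`, which is at most `2 ^ k * (M / 2)` as well,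
  -- so the bound doubles with `k`.
  have key : ∀ k ≤ N, ∫⁻ r in Set.Iio (k * (T / N) : ℝ), ‖b r‖ₑ ∂(lebT T) ≤
      ENNReal.ofReal (2 ^ k * (M / 2)) := by
    intro k
    induction k with
    | zero =>
      intro _
      have : (lebT T).restrict (Set.Iio 0) = 0 := by
        rw [Measure.restrict_restrict measurableSet_Iio, Measure.restrict_eq_zero]
        convert measure_empty (μ := (volume : Measure ℝ))
        ext x
        simp only [Set.mem_inter_iff, Set.mem_Iio, Set.mem_Ioo, Set.mem_empty_iff_false]
        grind
      simp [this]
    | succ k ih =>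
      intro hk
      have hle1 : ((k + 1 : ℕ) * (T / N) : ℝ) ≤ T := by
        have h2 : ((k + 1 : ℕ) : ℝ) ≤ N := by exact_mod_cast hk
        calc ((k + 1 : ℕ) * (T / N) : ℝ) ≤ N * (T / N) := by gcongr
          _ = T := by field_simp
      have h1 := eLpNorm_slice_driftExtension_sub_le hB hC
        (a := ((k + 1 : ℕ) * (T / N) : ℝ)) (by positivity) hle1 w₁ w₂
      have h2 : ‖restrictBelow ((k + 1 : ℕ) * (T / N) : ℝ) (w₁ - w₂)‖ₑ ≤
          ENNReal.ofReal (2 ^ (k + 1) * M) := by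
        rw [← ofReal_norm]
        exact ENNReal.ofReal_le_ofReal (hle (k + 1) hk)
      refine (lintegral_Iio_enorm_le hbm (a := (k * (T / N) : ℝ))).trans ?_
      have h3 : ((k + 1 : ℕ) * (T / N) : ℝ) - k * (T / N) = T / N := by push_cast; ring
      rw [h3]
      calc _ ≤ ENNReal.ofReal (2 ^ k * (M / 2)) + (C * ENNReal.ofReal (2 ^ (k + 1) * M)) *
            ENNReal.ofReal (T / N) ^ (1 / 2 : ℝ) := by
            gcongr
            · exact ih (by omega)
            · exact h1.trans (by gcongr)
        _ = ENNReal.ofReal (2 ^ k * (M / 2) + C * (2 ^ (k + 1) * M) * √(T / N)) := by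
            rw [ENNReal.ofReal_rpow_of_nonneg (by positivity) (by norm_num), ← Real.sqrt_eq_rpow,
              ENNReal.ofReal_add (by positivity) (by positivity),
              ENNReal.ofReal_mul (p := C * (2 ^ (k + 1) * M)) (by positivity),
              ENNReal.ofReal_mul C.coe_nonneg,
              ENNReal.ofReal_coe_nnreal]
        _ ≤ ENNReal.ofReal (2 ^ (k + 1) * (M / 2)) := by
            refine ENNReal.ofReal_le_ofReal ?_
            have h4 : (2 ^ (k + 1) * M) * (C * √(T / N)) ≤ (2 ^ (k + 1) * M) * (1 / 4) := by
              gcongr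
            rw [pow_succ] at h4 ⊢
            linarith
  intro k hk
  have := (enorm_restrictBelow_driftIntegral_sub_le hB hs hst ht
    (k * (T / N) : ℝ) w₁ w₂).trans (key k hk)
  rw [← ofReal_norm] at this
  exact (ENNReal.ofReal_le_ofReal_iff (by positivity)).1 this

end Drift

/-! ### Gaussian limits and the Itô isometry for elementary integrals. -/

section Gaussian

theorem continuous_integral_Lp_two {Ω : Type*} {m : MeasurableSpace Ω} {P : Measure Ω}
    [IsFiniteMeasure P] : Continuous fun f : Lp ℝ 2 P => ∫ ω, f ω ∂P := by
  have h : ∀ f : Lp ℝ 2 P, ∫ ω, f ω ∂P =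
      inner ℝ (indicatorConstLp 2 MeasurableSet.univ (measure_ne_top P _) (1 : ℝ)) f := fun f => by
    rw [L2.inner_indicatorConstLp_one, Measure.restrict_univ]
  simp_rw [h]
  fun_prop

theorem continuous_variance_Lp_two {Ω : Type*} {m : MeasurableSpace Ω} {P : Measure Ω}
    [IsProbabilityMeasure P] : Continuous fun f : Lp ℝ 2 P => Var[f; P] := by
  have h1 : ∀ f : Lp ℝ 2 P, Var[f; P] = ‖f‖ ^ 2 - (∫ ω, f ω ∂P) ^ 2 := by
    intro f
    rw [variance_eq_sub (Lp.memLp f)]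
    congr 1
    rw [← real_inner_self_eq_norm_sq, L2.inner_def]
    simp [pow_two]
  have h2 : Continuous fun f : Lp ℝ 2 P => ∫ ω, f ω ∂P := continuous_integral_Lp_two
  simp_rw [h1]
  fun_prop

/-- The Gaussian random variables form a closed subset of `L²(Ω; E)`. -/
theorem hasGaussianLaw_of_tendsto_Lp {Ω E : Type*} {m : MeasurableSpace Ω} {P : Measure Ω}
    [IsProbabilityMeasure P] [NormedAddCommGroup E] [NormedSpace ℝ E] [MeasurableSpace E]
    [BorelSpace E] [CompleteSpace E] {F : ℕ → Lp E 2 P} {f : Lp E 2 P}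
    (hF : ∀ n, HasGaussianLaw (F n) P) (h : Tendsto F atTop (𝓝 f)) :
    HasGaussianLaw f P := by
  rw [hasGaussianLaw_iff_charFunDual_map_eq (Lp.aestronglyMeasurable f).aemeasurable]
  intro L
  set G : ℕ → Lp ℝ 2 P := fun n => L.compLp (F n) with hG
  have hGg : Tendsto G atTop (𝓝 (L.compLp f)) :=
    ((L.compLpL 2 P).continuous.tendsto f).comp h
  have hcoe : ∀ g : Lp E 2 P, L ∘ g =ᵐ[P] L.compLp g := fun g =>
    (L.coeFn_compLp g).mono fun _ h => h.symm
  have hchar : ∀ g : Lp E 2 P, charFunDual (P.map g) L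
      = ∫ ω, Complex.exp ((L.compLp g ω : ℝ) * Complex.I) ∂P := by
    intro g
    rw [charFunDual_apply, integral_map (Lp.aestronglyMeasurable g).aemeasurable
      (Continuous.aestronglyMeasurable (by fun_prop))]
    refine integral_congr_ae ?_
    filter_upwards [L.coeFn_compLp g] with ω hω
    rw [hω]
  have hn : ∀ n, ∫ ω, Complex.exp ((G n ω : ℝ) * Complex.I) ∂P
      = Complex.exp ((P[G n] : ℝ) * Complex.I - Var[G n; P] / 2) := by
    intro n
    rw [← hchar, (hF n).charFunDual_map_eq, variance_congr (hcoe _), integral_congr_ae (hcoe _)]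
  rw [hchar, variance_congr (hcoe _), integral_congr_ae (hcoe _)]
  -- Both sides of the Gaussian formula pass to the limit: the left by dominated convergence along
  -- an almost surely convergent subsequence, the integrands having modulus one; the right because
  -- mean and variance are continuous on `L²`.
  obtain ⟨ns, hns, hae⟩ := (tendstoInMeasure_of_tendsto_Lp hGg).exists_seq_tendsto_ae
  have hGs := hGg.comp hns.tendsto_atTop
  have hl : Tendsto (fun k => ∫ ω, Complex.exp ((G (ns k) ω : ℝ) * Complex.I) ∂P) atTop
      (𝓝 (∫ ω, Complex.exp ((L.compLp f ω : ℝ) * Complex.I) ∂P)) := by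
    refine tendsto_integral_of_dominated_convergence (fun _ => 1) (fun n => ?_)
      (integrable_const _) (fun n => ae_of_all _ fun ω => ?_) ?_
    · have := Lp.aestronglyMeasurable (G (ns n))
      have hc : Continuous fun x : ℝ => Complex.exp (x * Complex.I) := by fun_prop
      exact hc.comp_aestronglyMeasurable this
    · rw [Complex.norm_exp_ofReal_mul_I]
    · filter_upwards [hae] with ω hω
      exact ((by fun_prop : Continuous fun x : ℝ => Complex.exp (x * Complex.I)).tendsto _).comp hω
  have hr : Tendsto (fun k => Complex.exp ((P[G (ns k)] : ℝ) * Complex.I - Var[G (ns k); P] / 2))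
      atTop (𝓝 (Complex.exp ((P[L.compLp f] : ℝ) * Complex.I - Var[L.compLp f; P] / 2))) := by
    have h1 : Continuous fun f : Lp ℝ 2 P => ∫ ω, f ω ∂P := continuous_integral_Lp_two
    have h2 := continuous_variance_Lp_two (P := P)
    exact ((by fun_prop : Continuous fun f : Lp ℝ 2 P =>
      Complex.exp ((P[f] : ℝ) * Complex.I - Var[f; P] / 2)).tendsto _).comp hGs
  refine tendsto_nhds_unique hl (hr.congr fun k => (hn _).symm)

/-! ### Elementary integrals -/

section Elementary

variable {Ω : Type*} {m : MeasurableSpace Ω} {P : Measure Ω}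
  {d : ℕ} {T : ℝ≥0} {𝓕 : Filtration (Set.Iic T) m} {W : ℝ≥0 → Ω → Rd d}

theorem IsBrownianMotion.memLp_increment (hW : IsBrownianMotion W 𝓕 P) (a b : ℝ≥0) (j : Fin d) :
    MemLp (fun ω => W b ω j - W a ω j) 2 P :=
  ((hW.coord j).hasLaw_sub b a).hasGaussianLaw.memLp_two

theorem IsBrownianMotion.integral_increment (hW : IsBrownianMotion W 𝓕 P) (a b : ℝ≥0)
    (j : Fin d) : ∫ ω, (W b ω j - W a ω j) ∂P = 0 := by
  rw [integral_sub ((hW.coord j).integrable_eval b) ((hW.coord j).integrable_eval a),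
    (hW.coord j).integral_eval, (hW.coord j).integral_eval, sub_zero]

/-- The length of the overlap is written as the combination of minima that the Brownian covariance
`min s t` produces for two increments. -/
theorem volume_real_Ioc_inter_Ioc {a b c e : ℝ≥0} (hab : a ≤ b) (hce : c ≤ e) :
    volume.real (Set.Ioc (a : ℝ) b ∩ Set.Ioc (c : ℝ) e) =
      ((min b e : ℝ≥0) : ℝ) - (min b c : ℝ≥0) - ((min a e : ℝ≥0) - (min a c : ℝ≥0)) := by
  rw [Set.Ioc_inter_Ioc, Real.volume_real_Ioc]
  have h1 : (a : ℝ) ≤ b := hab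
  have h2 : (c : ℝ) ≤ e := hce
  push_cast
  grind

/-- The covariance of increments of a Brownian motion. -/
theorem IsBrownianMotion.integral_increment_mul [IsProbabilityMeasure P]
    (hW : IsBrownianMotion W 𝓕 P) {a b c e : ℝ≥0}
    (hab : a ≤ b) (hce : c ≤ e) (j l : Fin d) :
    ∫ ω, (W b ω j - W a ω j) * (W e ω l - W c ω l) ∂P =
      if j = l then volume.real (Set.Ioc (a : ℝ) b ∩ Set.Ioc (c : ℝ) e) else 0 := by
  have h1 := covariance_eq_sub (hW.memLp_increment a b j) (hW.memLp_increment c e l)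
  rw [hW.integral_increment, zero_mul, sub_zero] at h1
  refine h1.symm.trans ?_
  split_ifs with hjl
  · subst hjl
    have hm : ∀ t, MemLp (fun ω => W t ω j) 2 P := fun t =>
      ((hW.coord j).hasLaw_eval t).hasGaussianLaw.memLp_two
    have hc := (hW.coord j).covariance_fun_eval
    rw [covariance_fun_sub_fun_sub (hm _) (hm _) (hm _) (hm _), hc, hc, hc, hc,
      volume_real_Ioc_inter_Ioc hab hce]
    ring
  · have hind := (hW.indep_coord.indepFun hjl).comp
      (φ := fun p : ℝ≥0 → ℝ => p b - p a) (ψ := fun p : ℝ≥0 → ℝ => p e - p c)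
      (by fun_prop) (by fun_prop)
    exact hind.covariance_eq_zero (hW.memLp_increment a b j) (hW.memLp_increment c e l)

variable {G : Type*} [NormedAddCommGroup G]

theorem apply_eq_sum_smul_single [NormedSpace ℝ G] (A : Rd d →L[ℝ] G) (x : Rd d) :
    A x = ∑ j, x j • A (EuclideanSpace.single j (1 : ℝ)) := by
  conv_lhs => rw [← (EuclideanSpace.basisFun (Fin d) ℝ).sum_repr x, map_sum]
  simp

/-- The elementary integral `∑ᵢ Aᵢ (W_{bᵢ} - W_{aᵢ})`. -/
def elemInt [NormedSpace ℝ G] {ι : Type*} [Fintype ι] (a b : ι → ℝ≥0) (A : ι → (Rd d →L[ℝ] G))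
    (W : ℝ≥0 → Ω → Rd d) (ω : Ω) : G :=
  ∑ i, A i (W (b i) ω - W (a i) ω)

/-- The integrand `∑ᵢ 1_{(aᵢ, bᵢ]} Aᵢ`. -/
def elemFun [NormedSpace ℝ G] {ι : Type*} [Fintype ι] (a b : ι → ℝ≥0) (A : ι → (Rd d →L[ℝ] G))
    (r : ℝ) : Rd d →L[ℝ] G :=
  ∑ i, (Set.Ioc (a i : ℝ) (b i)).indicator (fun _ => A i) r

theorem elemInt_eq_sum [NormedSpace ℝ G] {ι : Type*} [Fintype ι] (a b : ι → ℝ≥0)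
    (A : ι → (Rd d →L[ℝ] G)) (W : ℝ≥0 → Ω → Rd d) (ω : Ω) :
    elemInt a b A W ω = ∑ p : ι × Fin d, (W (b p.1) ω p.2 - W (a p.1) ω p.2) •
      A p.1 (EuclideanSpace.single p.2 (1 : ℝ)) := by
  rw [elemInt, Fintype.sum_prod_type]
  refine Finset.sum_congr rfl fun i _ => ?_
  rw [apply_eq_sum_smul_single]
  rfl

theorem memLp_elemInt [NormedSpace ℝ G] (hW : IsBrownianMotion W 𝓕 P) {ι : Type*} [Fintype ι]
    (a b : ι → ℝ≥0) (A : ι → (Rd d →L[ℝ] G)) : MemLp (elemInt a b A W) 2 P := by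
  have e : elemInt a b A W = fun ω => ∑ p : ι × Fin d, (W (b p.1) ω p.2 - W (a p.1) ω p.2) •
      A p.1 (EuclideanSpace.single p.2 (1 : ℝ)) := funext (elemInt_eq_sum a b A W)
  rw [e]
  refine memLp_finsetSum _ fun p _ => ?_
  simpa [Function.comp_def] using (ContinuousLinearMap.toSpanSingleton ℝ
    (A p.1 (EuclideanSpace.single p.2 (1 : ℝ)))).comp_memLp' (hW.memLp_increment (a p.1) (b p.1) p.2)

/-- The integral is a linear image of the vector of all coordinates of `W` at the finitely many
endpoints, which is jointly Gaussian because the coordinates are independent and each is a Gaussian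
process. -/
theorem hasGaussianLaw_elemInt [NormedSpace ℝ G] [MeasurableSpace G] [BorelSpace G]
    (hW : IsBrownianMotion W 𝓕 P) {ι : Type*} [Fintype ι]
    (a b : ι → ℝ≥0) (A : ι → (Rd d →L[ℝ] G)) : HasGaussianLaw (elemInt a b A W) P := by
  classical
  set I : Finset ℝ≥0 := Finset.univ.image a ∪ Finset.univ.image b
  have ha : ∀ i, a i ∈ I := fun i => by simp [I]
  have hb : ∀ i, b i ∈ I := fun i => by simp [I]
  have hjoint : HasGaussianLaw (fun ω (j : Fin d) => I.restrict (fun t => W t ω j)) P := by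
    refine iIndepFun.hasGaussianLaw (X := fun (j : Fin d) ω => I.restrict (fun t => W t ω j))
      (fun j => ((hW.coord j).hasLaw I).hasGaussianLaw) ?_
    exact hW.indep_coord.comp (fun _ p => I.restrict p) (fun _ => Finset.measurable_restrict I)
  let L : (Fin d → (I → ℝ)) →L[ℝ] G := ∑ p : ι × Fin d,
    (((ContinuousLinearMap.proj (R := ℝ) (φ := fun _ : I => ℝ) ⟨b p.1, hb p.1⟩ -
      ContinuousLinearMap.proj (R := ℝ) (φ := fun _ : I => ℝ) ⟨a p.1, ha p.1⟩).comp
      (ContinuousLinearMap.proj (R := ℝ) (φ := fun _ : Fin d => (I → ℝ)) p.2)).smulRight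
        (A p.1 (EuclideanSpace.single p.2 (1 : ℝ))))
  convert hjoint.map_fun L using 1
  funext ω
  rw [elemInt_eq_sum]
  simp [L]

theorem hsNormSq_eq_ofReal [NormedSpace ℝ G] (A : Rd d →L[ℝ] G) :
    hsNormSq A = ENNReal.ofReal (∑ j, ‖A (EuclideanSpace.single j (1 : ℝ))‖ ^ 2) := by
  rw [hsNormSq, ENNReal.ofReal_sum_of_nonneg fun _ _ => by positivity]
  refine Finset.sum_congr rfl fun j _ => ?_
  rw [ENNReal.ofReal_pow (norm_nonneg _), ofReal_norm]

theorem norm_sum_smul_sq [InnerProductSpace ℝ G] {κ : Type*} [Fintype κ] (x : κ → ℝ)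
    (v : κ → G) :
    ‖∑ p, x p • v p‖ ^ 2 = ∑ p, ∑ q, (x p * x q) * inner ℝ (v p) (v q) := by
  rw [← real_inner_self_eq_norm_sq, sum_inner]
  refine Finset.sum_congr rfl fun p _ => ?_
  rw [inner_sum]
  refine Finset.sum_congr rfl fun q _ => ?_
  rw [real_inner_smul_left, real_inner_smul_right]
  ring

/-- Expanding the square leaves covariances of increments: distinct coordinates cancel, equal ones
give overlap lengths. `integral_hs_elemFun` produces the same triple sum from the integrand, and
equating the two is the isometry. -/
theorem integral_norm_elemInt_sq [InnerProductSpace ℝ G] [IsProbabilityMeasure P]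
    (hW : IsBrownianMotion W 𝓕 P)
    {ι : Type*} [Fintype ι] {a b : ι → ℝ≥0} (hab : ∀ i, a i ≤ b i) (A : ι → (Rd d →L[ℝ] G)) :
    ∫ ω, ‖elemInt a b A W ω‖ ^ 2 ∂P = ∑ j, ∑ i, ∑ k,
      volume.real (Set.Ioc (a i : ℝ) (b i) ∩ Set.Ioc (a k : ℝ) (b k)) *
        inner ℝ (A i (EuclideanSpace.single j (1 : ℝ))) (A k (EuclideanSpace.single j (1 : ℝ))) := by
  have hint : ∀ p q : ι × Fin d, Integrable (fun ω => (W (b p.1) ω p.2 - W (a p.1) ω p.2) *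
      (W (b q.1) ω q.2 - W (a q.1) ω q.2)) P := fun p q =>
    (hW.memLp_increment (a p.1) (b p.1) p.2).integrable_mul (hW.memLp_increment (a q.1) (b q.1) q.2)
  simp_rw [elemInt_eq_sum, norm_sum_smul_sq]
  rw [integral_finsetSum _ fun p _ => integrable_finsetSum _ fun q _ => (hint p q).mul_const _]
  simp_rw [integral_finsetSum _ fun q _ => (hint _ q).mul_const _, integral_mul_const,
    hW.integral_increment_mul (hab _) (hab _), Fintype.sum_prod_type]
  rw [Finset.sum_comm]
  refine Finset.sum_congr rfl fun j _ => Finset.sum_congr rfl fun i _ =>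
    Finset.sum_congr rfl fun k _ => ?_
  simp

theorem integral_hs_elemFun [InnerProductSpace ℝ G]
    {ι : Type*} [Fintype ι] (a b : ι → ℝ≥0) (A : ι → (Rd d →L[ℝ] G)) :
    ∫⁻ r : ℝ, hsNormSq (elemFun a b A r) = ENNReal.ofReal (∑ j, ∑ i, ∑ k,
      volume.real (Set.Ioc (a i : ℝ) (b i) ∩ Set.Ioc (a k : ℝ) (b k)) *
        inner ℝ (A i (EuclideanSpace.single j (1 : ℝ)))
          (A k (EuclideanSpace.single j (1 : ℝ)))) := by
  set J : ι → ℝ → ℝ := fun i => (Set.Ioc (a i : ℝ) (b i)).indicator 1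
  have hmul : ∀ i k, (fun r => J i r * J k r) =
      (Set.Ioc (a i : ℝ) (b i) ∩ Set.Ioc (a k : ℝ) (b k)).indicator 1 := fun i k => by
    rw [Set.inter_indicator_one]; rfl
  have hJ : ∀ i k, Integrable fun r => J i r * J k r := fun i k => by
    rw [hmul]
    refine (integrable_indicator_iff (measurableSet_Ioc.inter measurableSet_Ioc)).2 ?_
    refine integrableOn_const (C := (1 : ℝ)) ?_
    exact ne_top_of_le_ne_top measure_Ioc_lt_top.ne (measure_mono Set.inter_subset_left)
  have hJi : ∀ i k, ∫ r, J i r * J k r =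
      volume.real (Set.Ioc (a i : ℝ) (b i) ∩ Set.Ioc (a k : ℝ) (b k)) := fun i k => by
    rw [hmul, integral_indicator_one (measurableSet_Ioc.inter measurableSet_Ioc)]
  have e : ∀ r, ∑ j, ‖elemFun a b A r (EuclideanSpace.single j (1 : ℝ))‖ ^ 2 =
      ∑ j, ∑ i, ∑ k, (J i r * J k r) * inner ℝ (A i (EuclideanSpace.single j (1 : ℝ)))
          (A k (EuclideanSpace.single j (1 : ℝ))) := by
    intro r
    refine Finset.sum_congr rfl fun j _ => ?_
    rw [← norm_sum_smul_sq, elemFun, sum_apply]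
    congr 2
    refine Finset.sum_congr rfl fun i _ => ?_
    by_cases h : r ∈ Set.Ioc (a i : ℝ) (b i) <;> simp [J, h]
  have hI : ∀ j : Fin d, ∀ i k : ι, Integrable fun r => (J i r * J k r) *
      inner ℝ (A i (EuclideanSpace.single j (1 : ℝ))) (A k (EuclideanSpace.single j (1 : ℝ))) :=
    fun j i k => (hJ i k).mul_const _
  simp_rw [hsNormSq_eq_ofReal]
  rw [← ofReal_integral_eq_lintegral_ofReal]
  · simp_rw [e]
    rw [integral_finsetSum _ fun j _ => integrable_finsetSum _ fun i _ =>
      integrable_finsetSum _ fun k _ => hI j i k]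
    simp_rw [integral_finsetSum _ fun i _ => integrable_finsetSum _ fun k _ => hI _ i k,
      integral_finsetSum _ fun k _ => hI _ _ k, integral_mul_const, hJi]
  · simp_rw [e]
    exact integrable_finsetSum _ fun j _ => integrable_finsetSum _ fun i _ =>
      integrable_finsetSum _ fun k _ => hI j i k
  · exact ae_of_all _ fun r => Finset.sum_nonneg fun j _ => by positivity

/-- The Itô isometry for elementary integrals. -/
theorem eLpNorm_elemInt_sq [InnerProductSpace ℝ G] [IsProbabilityMeasure P]
    (hW : IsBrownianMotion W 𝓕 P)
    {ι : Type*} [Fintype ι] {a b : ι → ℝ≥0} (hab : ∀ i, a i ≤ b i) (A : ι → (Rd d →L[ℝ] G)) :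
    eLpNorm (elemInt a b A W) 2 P ^ 2 = ∫⁻ r : ℝ, hsNormSq (elemFun a b A r) := by
  rw [integral_hs_elemFun, ← integral_norm_elemInt_sq hW hab, eLpNorm_two_sq,
    ofReal_integral_eq_lintegral_ofReal (memLp_elemInt hW a b A).integrable_norm_pow'
      (ae_of_all _ fun _ => by positivity)]
  refine lintegral_congr fun ω => ?_
  rw [ENNReal.ofReal_pow (norm_nonneg _), ofReal_norm]

end Elementary

end Gaussian

/-! ### The Wiener integral: uniqueness, additivity, existence. -/

section StochasticIntegral

section Wiener

variable {Ω : Type*} {m : MeasurableSpace Ω} {P : Measure Ω}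
  {d : ℕ} {T : ℝ≥0} {𝓕 : Filtration (Set.Iic T) m} {W : ℝ≥0 → Ω → Rd d}
  {G : Type*} [NormedAddCommGroup G]

/-- `X` is the elementary stochastic integral of the step function `f`. -/
def IsElementary [NormedSpace ℝ G] (W : ℝ≥0 → Ω → Rd d) (X : Ω → G) (f : ℝ → (Rd d →L[ℝ] G)) :
    Prop :=
  ∃ (ι : Type) (_ : Fintype ι) (a b : ι → ℝ≥0) (A : ι → (Rd d →L[ℝ] G)),
    (∀ i, a i ≤ b i) ∧ X = elemInt a b A W ∧ f = elemFun a b A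

/-- The two families are merely concatenated: intervals of an elementary integrand may overlap, so
no common refinement is needed. -/
theorem IsElementary.sub [NormedSpace ℝ G] {X Y : Ω → G} {f g : ℝ → (Rd d →L[ℝ] G)}
    (hX : IsElementary W X f) (hY : IsElementary W Y g) : IsElementary W (X - Y) (f - g) := by
  obtain ⟨ι, _, a, b, A, hab, rfl, rfl⟩ := hX
  obtain ⟨κ, _, a', b', A', hab', rfl, rfl⟩ := hY
  refine ⟨ι ⊕ κ, inferInstance, Sum.elim a a', Sum.elim b b', Sum.elim A (-A'), ?_, ?_, ?_⟩
  · rintro (i | i)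
    exacts [hab i, hab' i]
  · funext ω
    simp only [Pi.sub_apply, elemInt, Fintype.sum_sum_type, Sum.elim_inl, Sum.elim_inr,
      Pi.neg_apply, neg_apply, Finset.sum_neg_distrib, ← sub_eq_add_neg]
  · funext r
    simp [elemFun, sub_eq_add_neg, Set.indicator_neg]

theorem IsElementary.stronglyMeasurable [NormedSpace ℝ G] {X : Ω → G} {f : ℝ → (Rd d →L[ℝ] G)}
    (hX : IsElementary W X f) : StronglyMeasurable f := by
  obtain ⟨ι, _, a, b, A, -, -, rfl⟩ := hX
  unfold elemFun
  exact Finset.stronglyMeasurable_fun_sum _ fun i _ =>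
    stronglyMeasurable_const.indicator measurableSet_Ioc

theorem IsElementary.memLp [NormedSpace ℝ G] {X : Ω → G} {f : ℝ → (Rd d →L[ℝ] G)}
    (hW : IsBrownianMotion W 𝓕 P) (hX : IsElementary W X f) : MemLp X 2 P := by
  obtain ⟨ι, _, a, b, A, -, rfl, -⟩ := hX
  exact memLp_elemInt hW a b A

theorem IsElementary.hasGaussianLaw [NormedSpace ℝ G] [MeasurableSpace G] [BorelSpace G]
    {X : Ω → G} {f : ℝ → (Rd d →L[ℝ] G)}
    (hW : IsBrownianMotion W 𝓕 P) (hX : IsElementary W X f) : HasGaussianLaw X P := by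
  obtain ⟨ι, _, a, b, A, -, rfl, -⟩ := hX
  exact hasGaussianLaw_elemInt hW a b A

theorem IsElementary.eLpNorm_sq [IsProbabilityMeasure P] [InnerProductSpace ℝ G] {X : Ω → G}
    {f : ℝ → (Rd d →L[ℝ] G)} (hW : IsBrownianMotion W 𝓕 P) (hX : IsElementary W X f) :
    eLpNorm X 2 P ^ 2 = ∫⁻ r, hsNormSq (f r) := by
  obtain ⟨ι, _, a, b, A, hab, rfl, rfl⟩ := hX
  exact eLpNorm_elemInt_sq hW hab A

theorem hsNormSq_sub_le [NormedSpace ℝ G] (A B : Rd d →L[ℝ] G) :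
    hsNormSq (A - B) ≤ 2 * (hsNormSq A + hsNormSq B) := by
  simp_rw [hsNormSq, ← Finset.sum_add_distrib, Finset.mul_sum]
  refine Finset.sum_le_sum fun j _ => ?_
  rw [sub_apply]
  refine (pow_le_pow_left' enorm_sub_le 2).trans ?_
  have := ENNReal.rpow_add_le_mul_rpow_add_rpow ‖A (EuclideanSpace.single j (1 : ℝ))‖ₑ
    ‖B (EuclideanSpace.single j (1 : ℝ))‖ₑ (p := 2) (by norm_num)
  norm_num at this
  exact this

theorem continuous_hsNormSq [NormedSpace ℝ G] :
    Continuous fun A : Rd d →L[ℝ] G => hsNormSq A := by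
  unfold hsNormSq
  refine continuous_finsetSum _ fun j _ => ?_
  have h : Continuous fun A : Rd d →L[ℝ] G => A (EuclideanSpace.single j (1 : ℝ)) := by fun_prop
  exact (ENNReal.continuous_pow 2).comp h.enorm

theorem hsNormSq_le [NormedSpace ℝ G] (A : Rd d →L[ℝ] G) : hsNormSq A ≤ d * ‖A‖ₑ ^ 2 := by
  unfold hsNormSq
  refine (Finset.sum_le_card_nsmul _ _ (‖A‖ₑ ^ 2) fun j _ => ?_).trans (by simp)
  gcongr
  rw [enorm_le_iff_norm_le]
  simpa using A.le_opNorm (EuclideanSpace.single j (1 : ℝ))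

theorem lintegral_hsNormSq_sub_le [NormedSpace ℝ G] {μ : Measure ℝ} {f g : ℝ → (Rd d →L[ℝ] G)}
    (hf : AEStronglyMeasurable f μ) :
    ∫⁻ r, hsNormSq (f r - g r) ∂μ ≤
      2 * (∫⁻ r, hsNormSq (f r) ∂μ + ∫⁻ r, hsNormSq (g r) ∂μ) := by
  have hm : AEMeasurable (fun r => hsNormSq (f r)) μ :=
    (continuous_hsNormSq.comp_aestronglyMeasurable hf).aemeasurable
  calc _ ≤ ∫⁻ r, 2 * (hsNormSq (f r) + hsNormSq (g r)) ∂μ :=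
        lintegral_mono fun r => hsNormSq_sub_le _ _
    _ = _ := by rw [lintegral_const_mul' _ _ (by simp), lintegral_add_left' hm]

/-- `Y` is the stochastic integral over `[0, ∞)` of the deterministic integrand `F`. -/
def IsWienerInt [NormedSpace ℝ G] (P : Measure Ω) (W : ℝ≥0 → Ω → Rd d)
    (F : ℝ → (Rd d →L[ℝ] G)) (Y : Ω → G) : Prop :=
  AEStronglyMeasurable F ∧ AEStronglyMeasurable Y P ∧
  ∃ (X : ℕ → Ω → G) (f : ℕ → ℝ → (Rd d →L[ℝ] G)), (∀ k, IsElementary W (X k) (f k)) ∧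
    Tendsto (fun k => ∫⁻ r, hsNormSq (f k r - F r)) atTop (𝓝 0) ∧
    Tendsto (fun k => eLpNorm (X k - Y) 2 P) atTop (𝓝 0)

theorem IsWienerInt.sub [NormedSpace ℝ G] {F F' : ℝ → (Rd d →L[ℝ] G)} {Y Y' : Ω → G}
    (hW : IsBrownianMotion W 𝓕 P) (h : IsWienerInt P W F Y) (h' : IsWienerInt P W F' Y') :
    IsWienerInt P W (F - F') (Y - Y') := by
  obtain ⟨hF, hY, X, f, hX, hf, hXY⟩ := h
  obtain ⟨hF', hY', X', f', hX', hf', hXY'⟩ := h'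
  refine ⟨hF.sub hF', hY.sub hY', fun k => X k - X' k, fun k => f k - f' k,
    fun k => (hX k).sub (hX' k), ?_, ?_⟩
  · refine tendsto_of_tendsto_of_tendsto_of_le_of_le tendsto_const_nhds
      (h := fun k => 2 * ((∫⁻ r, hsNormSq (f k r - F r)) + ∫⁻ r, hsNormSq (f' k r - F' r))) ?_
      (fun _ => zero_le) fun k => ?_
    · simpa using ENNReal.Tendsto.const_mul (a := 2) (hf.add hf') (by simp)
    · refine le_trans (le_of_eq ?_) (lintegral_hsNormSq_sub_le (g := fun r => f' k r - F' r)
        ((hX k).stronglyMeasurable.aestronglyMeasurable.sub hF))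
      refine lintegral_congr fun r => ?_
      change hsNormSq (f k r - f' k r - (F r - F' r)) = hsNormSq (f k r - F r - (f' k r - F' r))
      rw [sub_sub_sub_comm]
  · refine tendsto_of_tendsto_of_tendsto_of_le_of_le tendsto_const_nhds
      (h := fun k => eLpNorm (X k - Y) 2 P + eLpNorm (X' k - Y') 2 P) ?_
      (fun _ => zero_le) fun k => ?_
    · simpa using hXY.add hXY'
    · change eLpNorm (X k - X' k - (Y - Y')) 2 P ≤ _
      rw [sub_sub_sub_comm]
      exact eLpNorm_sub_le (((hX k).memLp hW).1.sub hY) (((hX' k).memLp hW).1.sub hY') one_le_two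

/-- By the isometry the elementary integrals tend to `0` in `L²`, while they also tend to `Y`.
Uniqueness and additivity of the integral reduce to this case by linearity. -/
theorem IsWienerInt.ae_eq_zero [IsProbabilityMeasure P] [InnerProductSpace ℝ G] {Y : Ω → G}
    (hW : IsBrownianMotion W 𝓕 P)
    (h : IsWienerInt P W (0 : ℝ → (Rd d →L[ℝ] G)) Y) : Y =ᵐ[P] 0 := by
  obtain ⟨-, hY, X, f, hX, hf, hXY⟩ := h
  have h1 : Tendsto (fun k => eLpNorm (X k) 2 P ^ 2) atTop (𝓝 0) := by
    refine hf.congr fun k => ?_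
    rw [(hX k).eLpNorm_sq hW]
    simp
  have h2 : Tendsto (fun k => eLpNorm (X k) 2 P) atTop (𝓝 0) := by
    have := ((ENNReal.continuous_rpow_const (y := (2⁻¹ : ℝ))).tendsto _).comp h1
    refine (this.congr fun k => ?_).trans (by simp)
    simp only [Function.comp_apply]
    rw [← ENNReal.rpow_natCast, ← ENNReal.rpow_mul]
    simp
  have h3 : eLpNorm Y 2 P ≤ 0 := by
    refine ge_of_tendsto' (by simpa using h2.add hXY :
      Tendsto (fun k => eLpNorm (X k) 2 P + eLpNorm (X k - Y) 2 P) atTop (𝓝 0)) fun k => ?_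
    have hXm := ((hX k).memLp hW).1
    calc eLpNorm Y 2 P = eLpNorm (X k - (X k - Y)) 2 P := by rw [sub_sub_cancel]
      _ ≤ _ := eLpNorm_sub_le hXm (hXm.sub hY) one_le_two
  exact (eLpNorm_eq_zero_iff hY (by simp)).1 (le_antisymm h3 zero_le)

theorem StepIntegrand.isElementary [NormedSpace ℝ G] {s t : ℝ≥0} (S : StepIntegrand d G s t) :
    IsElementary W (S.stochInt W) S.eval :=
  ⟨Fin S.n, inferInstance, fun i => S.τ i.castSucc, fun i => S.τ i.succ, S.val,
    fun i => S.mono (Fin.castSucc_le_succ i), rfl, rfl⟩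

theorem StepIntegrand.eval_eq_zero [NormedSpace ℝ G] {s t : ℝ≥0} (S : StepIntegrand d G s t)
    {r : ℝ} (hr : r ∉ Set.Ioc (s : ℝ) t) : S.eval r = 0 := by
  refine Finset.sum_eq_zero fun i _ => Set.indicator_of_notMem (fun h => hr ⟨?_, ?_⟩) _
  · exact lt_of_le_of_lt (by exact_mod_cast (S.mem i.castSucc).1) h.1
  · exact h.2.trans (by exact_mod_cast (S.mem i.succ).2)

theorem StepIntegrand.eval_eq_val [NormedSpace ℝ G] {s t : ℝ≥0} (S : StepIntegrand d G s t)
    {r : ℝ} {i : Fin S.n} (hr : r ∈ Set.Ioc (S.τ i.castSucc : ℝ) (S.τ i.succ)) :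
    S.eval r = S.val i := by
  rw [StepIntegrand.eval, Finset.sum_eq_single i, Set.indicator_of_mem hr]
  · intro k _ hki
    refine Set.indicator_of_notMem (fun h => ?_) _
    rcases lt_or_gt_of_ne hki with hlt | hlt
    · have h1 : S.τ k.succ ≤ S.τ i.castSucc := S.mono (by simpa [Fin.le_iff_val_le_val] using hlt)
      have h2 : (S.τ k.succ : ℝ) ≤ S.τ i.castSucc := h1
      linarith [h.2, hr.1]
    · have h1 : S.τ i.succ ≤ S.τ k.castSucc := S.mono (by simpa [Fin.le_iff_val_le_val] using hlt)
      have h2 : (S.τ i.succ : ℝ) ≤ S.τ k.castSucc := h1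
      linarith [hr.2, h.1]
  · simp

theorem StepIntegrand.stronglyMeasurable_stochInt [NormedSpace ℝ G] {s : ℝ≥0} {t : Set.Iic T}
    (hW : IsBrownianMotion W 𝓕 P) (S : StepIntegrand d G s t) :
    StronglyMeasurable[𝓕 t] (S.stochInt W) := by
  have hm : ∀ i, StronglyMeasurable[𝓕 t] (W (S.τ i)) := fun i => by
    have hle : S.τ i ≤ t := (S.mem i).2
    have h1 := hW.adapted ⟨S.τ i, hle.trans t.2⟩
    exact (h1.mono (𝓕.mono hle) le_rfl).stronglyMeasurable
  unfold StepIntegrand.stochInt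
  exact Finset.stronglyMeasurable_fun_sum _ fun i _ =>
    (S.val i).continuous.comp_stronglyMeasurable ((hm _).sub (hm _))

theorem StepIntegrand.lintegral_hsNormSq_sub [NormedSpace ℝ G] {s t : ℝ≥0}
    (S : StepIntegrand d G s t) (F : ℝ → (Rd d →L[ℝ] G)) :
    ∫⁻ r, hsNormSq (S.eval r - (Set.Ioc (s : ℝ) t).indicator F r) =
      ∫⁻ r in Set.Ioc (s : ℝ) t, hsNormSq (S.eval r - F r) := by
  rw [← lintegral_indicator measurableSet_Ioc]
  refine lintegral_congr fun r => ?_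
  by_cases hr : r ∈ Set.Ioc (s : ℝ) t
  · simp [hr]
  · simp [hr, S.eval_eq_zero hr, hsNormSq]

/-- Extending integrands by zero puts integrals over different intervals on the same line, where
they can be subtracted. -/
theorem IsStochInt.isWienerInt [NormedSpace ℝ G] {F : ℝ → (Rd d →L[ℝ] G)} {s t : ℝ≥0} {Y : Ω → G}
    (h : IsStochInt P W F s t Y) : IsWienerInt P W ((Set.Ioc (s : ℝ) t).indicator F) Y := by
  obtain ⟨hF, hY, S, hS, hSY⟩ := h
  refine ⟨(aestronglyMeasurable_indicator_iff measurableSet_Ioc).2 hF, hY.1,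
    fun k => (S k).stochInt W, fun k => (S k).eval, fun k => (S k).isElementary, ?_, hSY⟩
  simpa only [StepIntegrand.lintegral_hsNormSq_sub] using hS

/-- Stochastic integrals are determined up to null sets. -/
theorem IsStochInt.ae_unique [IsProbabilityMeasure P] [InnerProductSpace ℝ G]
    (hW : IsBrownianMotion W 𝓕 P) {F : ℝ → (Rd d →L[ℝ] G)} {s t : ℝ≥0} {Y Y' : Ω → G}
    (h : IsStochInt P W F s t Y) (h' : IsStochInt P W F s t Y') : Y =ᵐ[P] Y' := by
  have h1 := h.isWienerInt.sub hW h'.isWienerInt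
  rw [sub_self] at h1
  filter_upwards [h1.ae_eq_zero hW] with ω hω
  exact sub_eq_zero.1 hω

/-- Stochastic integrals are additive with respect to the interval of integration. -/
theorem IsStochInt.ae_eq_add [IsProbabilityMeasure P] [InnerProductSpace ℝ G]
    (hW : IsBrownianMotion W 𝓕 P) {F : ℝ → (Rd d →L[ℝ] G)} {s u t : ℝ≥0} (hsu : s ≤ u)
    (hut : u ≤ t) {Y Y₁ Y₂ : Ω → G} (h : IsStochInt P W F s t Y)
    (h₁ : IsStochInt P W F s u Y₁) (h₂ : IsStochInt P W F u t Y₂) :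
    Y =ᵐ[P] fun ω => Y₁ ω + Y₂ ω := by
  have h3 := (h.isWienerInt.sub hW h₁.isWienerInt).sub hW h₂.isWienerInt
  have e : (Set.Ioc (s : ℝ) t).indicator F - (Set.Ioc (s : ℝ) u).indicator F -
      (Set.Ioc (u : ℝ) t).indicator F = 0 := by
    rw [← Set.Ioc_union_Ioc_eq_Ioc (NNReal.coe_le_coe.2 hsu) (NNReal.coe_le_coe.2 hut),
      Set.indicator_union_of_disjoint]
    · funext r
      simp
    · exact Set.Ioc_disjoint_Ioc_of_le le_rfl
  rw [e] at h3
  filter_upwards [h3.ae_eq_zero hW] with ω hω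
  have : Y ω - Y₁ ω - Y₂ ω = 0 := hω
  rw [sub_sub, sub_eq_zero] at this
  exact this

/-! ### Existence of stochastic integrals of continuous integrands -/

/-- The left-endpoint step function of `F` on the uniform partition of `[s, t]`. -/
def riemannStep [NormedSpace ℝ G] (F : ℝ → (Rd d →L[ℝ] G)) {s t : ℝ≥0} (hst : s ≤ t) (k : ℕ) :
    StepIntegrand d G s t where
  n := k + 1
  τ i := s + (i : ℕ) * ((t - s) / (k + 1))
  mono i j hij := by
    have : ((i : ℕ) : ℝ≥0) ≤ (j : ℕ) := by exact_mod_cast hij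
    change s + ((i : ℕ) : ℝ≥0) * _ ≤ s + ((j : ℕ) : ℝ≥0) * _
    gcongr
  mem i := by
    refine ⟨le_self_add, ?_⟩
    have hi : ((i : ℕ) : ℝ≥0) ≤ k + 1 := by exact_mod_cast Nat.lt_succ_iff.1 i.2
    calc s + (i : ℕ) * ((t - s) / (k + 1)) ≤ s + (k + 1) * ((t - s) / (k + 1)) := by gcongr
      _ = t := by
        rw [mul_div_cancel₀ _ (by positivity), add_tsub_cancel_of_le hst]
  val i := F ((s + (i : ℕ) * ((t - s) / (k + 1)) : ℝ≥0) : ℝ)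

theorem exists_partition_interval {n : ℕ} {τ : Fin (n + 1) → ℝ≥0} {r : ℝ} (h0 : (τ 0 : ℝ) < r)
    (hlast : r ≤ τ (Fin.last n)) :
    ∃ i : Fin n, r ∈ Set.Ioc (τ i.castSucc : ℝ) (τ i.succ) := by
  by_contra! H
  have : ∀ i : Fin (n + 1), (τ i : ℝ) < r := fun i => by
    induction i using Fin.induction with
    | zero => exact h0
    | succ i ih => exact not_le.1 fun h => H i ⟨ih, h⟩
  exact absurd hlast (not_le.2 (this _))

theorem exists_riemannStep_eval [NormedSpace ℝ G] (F : ℝ → (Rd d →L[ℝ] G)) {s t : ℝ≥0}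
    (hst : s ≤ t) (k : ℕ) {r : ℝ} (hr : r ∈ Set.Ioc (s : ℝ) t) :
    ∃ r' ∈ Set.Icc (s : ℝ) t, |r' - r| ≤ ((t : ℝ) - s) / (k + 1) ∧
      (riemannStep F hst k).eval r = F r' := by
  set S := riemannStep F hst k
  have hk : (k + 1 : ℝ≥0) ≠ 0 := by positivity
  have h0 : (S.τ 0 : ℝ) < r := by simpa [S, riemannStep] using hr.1
  have hlast : r ≤ S.τ (Fin.last _) := by
    have : S.τ (Fin.last _) = t := by
      simp only [S, riemannStep, Fin.val_last]
      push_cast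
      rw [mul_div_cancel₀ _ hk, add_tsub_cancel_of_le hst]
    rw [this]
    exact hr.2
  obtain ⟨i, hi⟩ := exists_partition_interval h0 hlast
  refine ⟨S.τ i.castSucc, ?_, ?_, S.eval_eq_val hi⟩
  · have := S.mem i.castSucc
    exact ⟨by exact_mod_cast this.1, by exact_mod_cast this.2⟩
  · have hstep : (S.τ i.succ : ℝ) = S.τ i.castSucc + ((t : ℝ) - s) / (k + 1) := by
      have e1 : S.τ i.succ = s + ((i : ℕ) + 1 : ℕ) * ((t - s) / (k + 1)) := rfl
      have e2 : S.τ i.castSucc = s + (i : ℕ) * ((t - s) / (k + 1)) := rfl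
      rw [e1, e2]
      push_cast [NNReal.coe_sub hst]
      ring
    rw [abs_sub_comm, abs_of_nonneg (by linarith [hi.1])]
    linarith [hi.2]

/-- Uniform continuity on the compact interval makes the step functions converge uniformly, and the
Hilbert–Schmidt norm is controlled by the operator norm because `ℝ^d` is finite-dimensional. -/
theorem tendsto_riemannStep [NormedSpace ℝ G] {F : ℝ → (Rd d →L[ℝ] G)} {s t : ℝ≥0}
    (hst : s ≤ t) (hF : ContinuousOn F (Set.Icc (s : ℝ) t)) :
    Tendsto (fun k => ∫⁻ r in Set.Ioc (s : ℝ) t,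
      hsNormSq ((riemannStep F hst k).eval r - F r)) atTop (𝓝 0) := by
  have huc := isCompact_Icc.uniformContinuousOn_of_continuous hF
  rw [Metric.uniformContinuousOn_iff] at huc
  rw [ENNReal.tendsto_nhds_zero]
  intro ε hε
  have hφ : Tendsto (fun η : ℝ => d * ENNReal.ofReal η ^ 2 * volume (Set.Ioc (s : ℝ) t))
      (𝓝[>] 0) (𝓝 0) := by
    have h1 : Tendsto (fun η : ℝ => ENNReal.ofReal η) (𝓝[>] 0) (𝓝 0) := by
      simpa using (ENNReal.continuous_ofReal.tendsto 0).mono_left nhdsWithin_le_nhds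
    have h2 := ENNReal.Tendsto.const_mul (a := (d : ℝ≥0∞)) (ENNReal.Tendsto.pow (n := 2) h1)
      (by simp)
    have h3 := ENNReal.Tendsto.mul_const (b := volume (Set.Ioc (s : ℝ) t)) h2
      (Or.inr measure_Ioc_lt_top.ne)
    simpa using h3
  obtain ⟨η, hη1, hη2⟩ := ((ENNReal.tendsto_nhds_zero.1 hφ ε hε).and self_mem_nhdsWithin).exists
  obtain ⟨δ, hδ, hFδ⟩ := huc η hη2
  have hmesh : Tendsto (fun k : ℕ => ((t : ℝ) - s) / (k + 1)) atTop (𝓝 0) :=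
    tendsto_const_nhds.div_atTop (tendsto_natCast_atTop_atTop.atTop_add tendsto_const_nhds)
  filter_upwards [hmesh.eventually_lt_const hδ] with k hk
  refine le_trans ?_ hη1
  rw [← setLIntegral_const]
  refine setLIntegral_mono measurable_const fun r hr => ?_
  obtain ⟨r', hr', hrr', e⟩ := exists_riemannStep_eval F hst k hr
  rw [e]
  refine (hsNormSq_le _).trans ?_
  gcongr
  rw [← ofReal_norm, ← dist_eq_norm]
  exact ENNReal.ofReal_le_ofReal
    (hFδ r' hr' r (Set.Ioc_subset_Icc_self hr) (hrr'.trans_lt hk)).le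

/-- The stochastic integral of a continuous integrand exists as the `L²` limit of Riemann sums. -/
theorem exists_tendsto_riemannStep [IsProbabilityMeasure P] [InnerProductSpace ℝ G]
    [CompleteSpace G] (hW : IsBrownianMotion W 𝓕 P) {F : ℝ → (Rd d →L[ℝ] G)} {s t : ℝ≥0}
    (hst : s ≤ t) (hF : ContinuousOn F (Set.Icc (s : ℝ) t)) :
    ∃ Y : Lp G 2 P, IsStochInt P W F s t Y ∧
      Tendsto (fun k => ((riemannStep F hst k).isElementary.memLp hW).toLp
        ((riemannStep F hst k).stochInt W)) atTop (𝓝 Y) := by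
  set S := riemannStep F hst
  set X : ℕ → Lp G 2 P := fun k => ((S k).isElementary.memLp hW).toLp ((S k).stochInt W)
  have hFm : AEStronglyMeasurable F (volume.restrict (Set.Ioc (s : ℝ) t)) :=
    (hF.mono Set.Ioc_subset_Icc_self).aestronglyMeasurable measurableSet_Ioc
  have hS := tendsto_riemannStep hst hF
  have hdist : ∀ k l, edist (X k) (X l) ^ 2 ≤
      2 * ((∫⁻ r in Set.Ioc (s : ℝ) t, hsNormSq ((S k).eval r - F r)) +
        ∫⁻ r in Set.Ioc (s : ℝ) t, hsNormSq ((S l).eval r - F r)) := by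
    intro k l
    have hkl := (S k).isElementary (W := W) |>.sub (S l).isElementary
    rw [Lp.edist_toLp_toLp, hkl.eLpNorm_sq hW]
    calc ∫⁻ r, hsNormSq ((S k).eval r - (S l).eval r) =
        ∫⁻ r in Set.Ioc (s : ℝ) t, hsNormSq (((S k).eval r - F r) - ((S l).eval r - F r)) := by
          rw [← lintegral_indicator measurableSet_Ioc]
          refine lintegral_congr fun r => ?_
          by_cases hr : r ∈ Set.Ioc (s : ℝ) t
          · simp [hr]
          · simp [hr, (S _).eval_eq_zero hr, hsNormSq]
      _ ≤ _ := lintegral_hsNormSq_sub_le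
          ((S k).isElementary (W := W) |>.stronglyMeasurable.aestronglyMeasurable.sub hFm)
  have hcauchy : CauchySeq X := by
    rw [EMetric.cauchySeq_iff]
    intro ε hε
    -- A quarter of `ε ^ 2`, since `hdist` has two error terms and a factor `2`.
    have hε' : 0 < ε ^ 2 / 2 / 2 :=
      ENNReal.half_pos (ENNReal.half_pos (ENNReal.pow_pos hε 2).ne').ne'
    obtain ⟨N, hN⟩ := eventually_atTop.1 (hS.eventually_lt_const hε')
    refine ⟨N, fun k hk l hl => ?_⟩
    have h1 := ENNReal.add_lt_add (hN k hk) (hN l hl)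
    rw [ENNReal.add_halves] at h1
    have h2 := (hdist k l).trans_lt (show _ < ε ^ 2 by
      rw [two_mul]
      exact (ENNReal.add_lt_add h1 h1).trans_eq (ENNReal.add_halves _))
    exact lt_of_pow_lt_pow_left' 2 h2
  obtain ⟨Y, hY⟩ := cauchySeq_tendsto_of_complete hcauchy
  refine ⟨Y, ⟨hFm, Lp.memLp Y, S, hS, ?_⟩, hY⟩
  have := tendsto_iff_edist_tendsto_0.1 hY
  refine this.congr fun k => ?_
  rw [Lp.edist_def]
  refine eLpNorm_congr_ae ?_
  filter_upwards [((S k).isElementary.memLp hW).coeFn_toLp] with ω hω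
  rw [Pi.sub_apply, hω]

/-- The Riemann sums use `W` only up to time `t`, and almost everywhere `𝓕 t`-measurability is
closed under `L²` limits. -/
theorem aestronglyMeasurable_of_tendsto_riemannStep [NormedSpace ℝ G] [CompleteSpace G]
    (hW : IsBrownianMotion W 𝓕 P) {F : ℝ → (Rd d →L[ℝ] G)} {s t : Set.Iic T} (hst : s ≤ t)
    {Y : Lp G 2 P}
    (hY : Tendsto (fun k => ((riemannStep F hst k).isElementary.memLp hW).toLp
        ((riemannStep F hst k).stochInt W)) atTop (𝓝 Y)) :
    AEStronglyMeasurable[𝓕 t] Y P := by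
  refine (isClosed_aestronglyMeasurable (𝓕.le t)).mem_of_tendsto hY
    (Eventually.of_forall fun k => ?_)
  exact ⟨_, StepIntegrand.stronglyMeasurable_stochInt hW _, MemLp.coeFn_toLp _⟩

/-- Only values of `F` at points of `[s, t]` enter the Riemann sums, so `R` annihilates them and, by
continuity, their limit. With `R` the restriction to `(0, s)`, this shows that the noise vanishes
there. -/
theorem ae_apply_eq_zero_of_tendsto_riemannStep [NormedSpace ℝ G] {E : Type*}
    [NormedAddCommGroup E] [NormedSpace ℝ E]
    (hW : IsBrownianMotion W 𝓕 P) {F : ℝ → (Rd d →L[ℝ] G)} {s t : ℝ≥0} (hst : s ≤ t)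
    (R : G →L[ℝ] E) (hR : ∀ r ∈ Set.Icc (s : ℝ) t, ∀ x, R (F r x) = 0)
    {Y : Lp G 2 P}
    (hY : Tendsto (fun k => ((riemannStep F hst k).isElementary.memLp hW).toLp
        ((riemannStep F hst k).stochInt W)) atTop (𝓝 Y)) :
    ∀ᵐ ω ∂P, R (Y ω) = 0 := by
  have h1 := ((R.compLpL 2 P).continuous.tendsto Y).comp hY
  have h2 : R.compLp Y = 0 := by
    refine tendsto_nhds_unique h1 (tendsto_const_nhds.congr fun k => ?_)
    refine (Lp.ext ?_).symm
    change R.compLp _ =ᵐ[P] _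
    filter_upwards [R.coeFn_compLp (((riemannStep F hst k).isElementary.memLp hW).toLp _),
      ((riemannStep F hst k).isElementary.memLp hW).coeFn_toLp, Lp.coeFn_zero E 2 P]
      with ω e1 e2 e3
    rw [e1, e2, e3, StepIntegrand.stochInt, map_sum]
    refine Finset.sum_eq_zero fun i _ => hR _ ?_ _
    have := (riemannStep F hst k).mem i.castSucc
    exact ⟨NNReal.coe_le_coe.2 this.1, NNReal.coe_le_coe.2 this.2⟩
  filter_upwards [R.coeFn_compLp Y, Lp.coeFn_zero E 2 P] with ω e1 e2
  rw [← e1, h2, e2]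
  rfl

end Wiener

end StochasticIntegral

/-! ### The stochastic convolution with the fractional kernel. -/

section NoiseIntegral

variable {d : ℕ} {T : ℝ≥0}

theorem noiseCoeff_coeFn (d : ℕ) (T : ℝ≥0) {α : ℝ} (hα : 1 / 2 < α) (t : ℝ) (x : Rd d) :
    noiseCoeff d T hα t x =ᵐ[lebT T] fun ξ => fracKernel α t ξ • x :=
  (fracKernel_smul_memLp d hα T t x).coeFn_toLp

theorem restrictBelow_noiseCoeff (d : ℕ) (T : ℝ≥0) {α : ℝ} (hα : 1 / 2 < α) {u t : ℝ}
    (hut : u ≤ t) (x : Rd d) : restrictBelow u (noiseCoeff d T hα t x) = 0 := by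
  rw [restrictBelow_eq_zero_iff]
  filter_upwards [noiseCoeff_coeFn d T hα t x] with ξ h1 h2
  rw [h1, fracKernel, if_neg (not_lt.2 (h2.le.trans hut)), zero_smul]

/-- The noise coefficient is continuous in operator norm, as translation is continuous in `L²`. -/
theorem continuousOn_noiseCoeff (d : ℕ) (T : ℝ≥0) {α : ℝ} (hα : 1 / 2 < α) :
    ContinuousOn (noiseCoeff d T hα) (Set.Icc (0 : ℝ) T) := by
  -- The kernel is not square-integrable at infinity, so it is truncated to `(0, T)`. For `t ≥ 0`
  -- the translate by `t` still equals the kernel started at `t` on `(0, T)`, since `ξ - t < T`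
  -- there.
  have hK : MemLp ((Set.Ioo (0 : ℝ) T).indicator (fracKernel α 0)) 2 (volume : Measure ℝ) :=
    (memLp_indicator_iff_restrict measurableSet_Ioo).2 (fracKernel_memLp hα T 0)
  set K : Lp ℝ 2 (volume : Measure ℝ) := hK.toLp _
  set τ : ℝ → Lp ℝ 2 (volume : Measure ℝ) := fun t => DomAddAct.mk (-t) +ᵥ K
  have hτ : Continuous τ := by
    have : Continuous fun t : ℝ => DomAddAct.mk (-t) :=
      DomAddAct.continuous_mk.comp continuous_neg
    exact this.vadd continuous_const
  have hτe : ∀ t ∈ Set.Icc (0 : ℝ) T, τ t =ᵐ[lebT T] fracKernel α t := by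
    intro t ht
    have h1 : τ t =ᵐ[volume] fun ξ => K (-t + ξ) := DomAddAct.vadd_Lp_ae_eq _ _
    have h2 : ∀ᵐ ξ ∂(volume : Measure ℝ),
        K (-t + ξ) = (Set.Ioo (0 : ℝ) T).indicator (fracKernel α 0) (-t + ξ) :=
      (measurePreserving_add_left volume (-t)).quasiMeasurePreserving.ae hK.coeFn_toLp
    filter_upwards [ae_restrict_of_ae h1, ae_restrict_of_ae h2, ae_restrict_mem measurableSet_Ioo]
      with ξ e1 e2 hξ
    rw [e1, e2]
    by_cases h : t < ξ
    · have hmem : -t + ξ ∈ Set.Ioo (0 : ℝ) T := ⟨by linarith, by linarith [hξ.2, ht.1]⟩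
      rw [Set.indicator_of_mem hmem, fracKernel, fracKernel,
        if_pos (by linarith), if_pos h]
      congr 2
      ring
    · rw [Set.indicator_of_notMem (fun h' => h (by linarith [h'.1])), fracKernel, if_neg h]
  have hle : ∀ t ∈ Set.Icc (0 : ℝ) T, ∀ r ∈ Set.Icc (0 : ℝ) T,
      dist (noiseCoeff d T hα t) (noiseCoeff d T hα r) ≤ dist (τ t) (τ r) := by
    intro t ht r hr
    rw [dist_eq_norm]
    refine ContinuousLinearMap.opNorm_le_bound _ dist_nonneg fun x => ?_
    have h1 : eLpNorm (fun ξ => (fracKernel α t ξ - fracKernel α r ξ) • x) 2 (lebT T) ≤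
        edist (τ t) (τ r) * ‖x‖ₑ := by
      have h2 : eLpNorm (fun ξ => fracKernel α t ξ - fracKernel α r ξ) 2 (lebT T) ≤
          edist (τ t) (τ r) := by
        rw [Lp.edist_def]
        refine le_trans (le_of_eq ?_) (eLpNorm_mono_measure (ν := lebT T) _ Measure.restrict_le_self)
        refine eLpNorm_congr_ae ?_
        filter_upwards [hτe t ht, hτe r hr] with ξ e1 e2
        rw [Pi.sub_apply, e1, e2]
      refine (eLpNorm_le_nnreal_smul_eLpNorm_of_ae_le_mul (c := ‖x‖₊)
        (g := fun ξ => fracKernel α t ξ - fracKernel α r ξ) (ae_of_all _ fun ξ => ?_) 2).trans ?_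
      · rw [nnnorm_smul, mul_comm]
      · rw [ENNReal.smul_def, smul_eq_mul, mul_comm]
        exact mul_le_mul_left h2 _
    have h3 : ‖(noiseCoeff d T hα t - noiseCoeff d T hα r) x‖ₑ =
        eLpNorm (fun ξ => (fracKernel α t ξ - fracKernel α r ξ) • x) 2 (lebT T) := by
      rw [sub_apply, Lp.enorm_def]
      refine eLpNorm_congr_ae ?_
      filter_upwards [Lp.coeFn_sub (noiseCoeff d T hα t x) (noiseCoeff d T hα r x),
        noiseCoeff_coeFn d T hα t x, noiseCoeff_coeFn d T hα r x] with ξ e1 e2 e3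
      rw [e1, Pi.sub_apply, e2, e3, sub_smul]
    rw [← h3] at h1
    have h4 := ENNReal.toReal_mono (ENNReal.mul_ne_top (edist_ne_top _ _) enorm_ne_top) h1
    rwa [toReal_enorm, ENNReal.toReal_mul, toReal_enorm, ← dist_edist] at h4
  intro t ht
  rw [ContinuousWithinAt, tendsto_iff_dist_tendsto_zero]
  refine squeeze_zero' (g := fun r => dist (τ r) (τ t)) (Eventually.of_forall fun _ => dist_nonneg)
    ?_ ?_
  · filter_upwards [self_mem_nhdsWithin] with r hr using hle r hr t ht
  · exact (tendsto_iff_dist_tendsto_zero.1 (hτ.tendsto t)).mono_left nhdsWithin_le_nhds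

section Noise

variable {Ω : Type*} {m : MeasurableSpace Ω} {P : Measure Ω} [IsProbabilityMeasure P]
  {𝓕 : Filtration (Set.Iic T) m} {W : ℝ≥0 → Ω → Rd d}

/-- The stochastic convolution `∫_s^t σ(r) dW_r` exists, has moments of all orders, is
`𝓕 t`-measurable, and vanishes on `(0, s)`. -/
theorem exists_noiseIntegral (hW : IsBrownianMotion W 𝓕 P) {α : ℝ} (hα : 1 / 2 < α)
    {s t : Set.Iic T} (hst : s ≤ t) :
    ∃ Y : Ω → HSpace d T, IsStochInt P W (noiseCoeff d T hα) s t Y ∧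
      (∀ q : ℝ≥0, MemLp Y q P) ∧ AEStronglyMeasurable[𝓕 t] Y P ∧
      ∀ᵐ ω ∂P, restrictBelow (s : ℝ≥0) (Y ω) = 0 := by
  borelize (HSpace d T)
  have hcont : ContinuousOn (noiseCoeff d T hα) (Set.Icc ((s : ℝ≥0) : ℝ) (t : ℝ≥0)) :=
    (continuousOn_noiseCoeff d T hα).mono
      (Set.Icc_subset_Icc (NNReal.coe_nonneg _) (NNReal.coe_le_coe.2 t.2))
  obtain ⟨Y, hY, hlim⟩ := exists_tendsto_riemannStep hW (show (s : ℝ≥0) ≤ t from hst) hcont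
  -- Gaussian elements have moments of all orders, which upgrades the `L²` construction to every
  -- `q`.
  have hgauss : HasGaussianLaw Y P := by
    refine hasGaussianLaw_of_tendsto_Lp (fun k => ?_) hlim
    have hel := (riemannStep (noiseCoeff d T hα) (show (s : ℝ≥0) ≤ t from hst) k).isElementary
      (W := W)
    exact (hel.hasGaussianLaw hW).congr (hel.memLp hW).coeFn_toLp.symm
  refine ⟨Y, hY, fun q => hgauss.memLp ENNReal.coe_ne_top,
    aestronglyMeasurable_of_tendsto_riemannStep hW hst hlim,
    ae_apply_eq_zero_of_tendsto_riemannStep hW hst (restrictBelow ((s : ℝ≥0) : ℝ)) ?_ hlim⟩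
  intro r hr x
  exact restrictBelow_noiseCoeff d T hα hr.1 x

end Noise

end NoiseIntegral

/-! ### Solving the stochastic equation and composing solutions. -/

section SolutionMap

variable {d : ℕ} {T : ℝ≥0}

/-- If `v` agrees with `w` up to time `u` then the drift over `[s, u]` does not distinguish them. -/
theorem driftIntegral_congr {B : PathSpace d T → HSqSpace d T} (hB : DriftAssumption B)
    {s u : ℝ} (hs : 0 ≤ s) (hsu : s ≤ u) (hu : u ≤ T) {v w : HSpace d T}
    (h : restrictBelow u (v - w) = 0) :
    driftIntegral (driftExtension hB) s u v = driftIntegral (driftExtension hB) s u w := by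
  -- Causality is only assumed at positive times; `u = 0` forces `s = u` and empty integrals.
  rcases (hs.trans hsu).eq_or_lt with h0 | h0
  · have : s = u := le_antisymm hsu (h0 ▸ hs)
    simp [driftIntegral, this]
  have hc := slice_driftExtension_causal hB h0 hu h
  rw [driftIntegral, driftIntegral, intervalIntegral.integral_of_le hsu,
    intervalIntegral.integral_of_le hsu, integral_Ioc_eq_integral_Ioo,
    integral_Ioc_eq_integral_Ioo]
  refine integral_congr_ae ?_
  have hle : volume.restrict (Set.Ioo s u) ≤ lebT T :=
    Measure.restrict_mono (Set.Ioo_subset_Ioo hs hu) le_rfl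
  filter_upwards [ae_mono hle hc, ae_restrict_mem measurableSet_Ioo] with r h1 h2
  exact h1 h2.2

/-- The drift accumulated after time `u` vanishes on `(0, u)`. -/
theorem restrictBelow_driftIntegral {B : PathSpace d T → HSqSpace d T} (hB : DriftAssumption B)
    {u t : ℝ} (hu : 0 ≤ u) (hut : u ≤ t) (ht : t ≤ T) (w : HSpace d T) :
    restrictBelow u (driftIntegral (driftExtension hB) u t w) = 0 := by
  rw [driftIntegral, ← ContinuousLinearMap.intervalIntegral_comp_comm _
    (intervalIntegrable_slice _ hu hut ht), intervalIntegral.integral_of_le hut,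
    integral_Ioc_eq_integral_Ioo]
  refine integral_eq_zero_of_ae ?_
  have hle : volume.restrict (Set.Ioo u t) ≤ lebT T :=
    Measure.restrict_mono (Set.Ioo_subset_Ioo hu ht) le_rfl
  filter_upwards [ae_mono hle (slice_driftExtension_volterra hB w),
    ae_restrict_mem measurableSet_Ioo] with r h1 h2
  exact restrictBelow_eq_zero_mono h2.1.le h1

section Solution

variable {Ω : Type*} {m : MeasurableSpace Ω} {P : Measure Ω} [IsProbabilityMeasure P]
  {𝓕 : Filtration (Set.Iic T) m} {W : ℝ≥0 → Ω → Rd d} {q : ℝ≥0}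

theorem memLp_lipschitz_comp {E F : Type*} [NormedAddCommGroup E] [NormedAddCommGroup F]
    {Θ : E → F} {L : ℝ≥0} (hΘ : LipschitzWith L Θ) {p : ℝ≥0∞} {f : Ω → E} (hf : MemLp f p P) :
    MemLp (fun ω => Θ (f ω)) p P := by
  have h1 : MemLp (fun ω => Θ (f ω) - Θ 0) p P := by
    refine hf.of_le_mul (c := L)
      ((hΘ.continuous.comp_aestronglyMeasurable hf.1).sub aestronglyMeasurable_const)
      (ae_of_all _ fun ω => ?_)
    simpa using hΘ.norm_sub_le (f ω) 0
  convert h1.add (memLp_const (Θ 0)) using 1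
  funext ω
  simp

/-- The solution map, with all its properties over a single interval. -/
theorem exists_solution (hT : 0 < T) {α : ℝ} (hα : 1 / 2 < α) (hW : IsBrownianMotion W 𝓕 P)
    {B : PathSpace d T → HSqSpace d T} (hB : DriftAssumption B)
    {s t : Set.Iic T} (hst : s ≤ t) (φ : RandomH P d T q) :
    ∃ w : RandomH P d T q, IsSolution hα W (driftExtension hB) s t φ w ∧
      (∀ w' : RandomH P d T q, IsSolution hα W (driftExtension hB) s t φ w' → w' = w) ∧
      (φ ∈ lpMeas (HSpace d T) ℝ (𝓕 s) q P → w ∈ lpMeas (HSpace d T) ℝ (𝓕 t) q P) := by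
  have hst' : ((s : ℝ≥0) : ℝ) ≤ (t : ℝ≥0) := NNReal.coe_le_coe.2 hst
  have ht' : ((t : ℝ≥0) : ℝ) ≤ T := NNReal.coe_le_coe.2 t.2
  obtain ⟨Y, hY, hYq, hYm, -⟩ := exists_noiseIntegral hW hα hst
  obtain ⟨Θ, hfix, huniq, L, hL⟩ := exists_driftSolution hB hT (NNReal.coe_nonneg s) hst' ht'
  have hmem : MemLp (fun ω => Θ (φ ω + Y ω)) q P :=
    memLp_lipschitz_comp hL ((Lp.memLp φ).add (hYq q))
  refine ⟨hmem.toLp _, ⟨Y, hY, ?_⟩, ?_, fun hφ => ?_⟩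
  · filter_upwards [hmem.coeFn_toLp] with ω hω
    refine ⟨intervalIntegrable_slice _ (NNReal.coe_nonneg _) hst' ht', ?_⟩
    rw [hω, add_right_comm]
    exact hfix _
  · rintro w' ⟨Y', hY', hw'⟩
    refine Lp.ext ?_
    -- Each solution comes with its own version of the stochastic integral; the versions are
    -- identified almost surely before pathwise uniqueness is applied.
    filter_upwards [hmem.coeFn_toLp, hw', hY.ae_unique hW hY'] with ω h1 h2 h3
    rw [h1, h3]
    refine huniq _ _ ?_
    rw [add_right_comm]
    exact h2.2
  · rw [mem_lpMeas_iff_aestronglyMeasurable] at hφ ⊢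
    exact (hL.continuous.comp_aestronglyMeasurable
      ((hφ.mono (𝓕.mono hst)).add hYm)).congr hmem.coeFn_toLp.symm

/-- Solving first over `[s, u]` and then over `[u, t]` solves the equation over `[s, t]`. -/
theorem IsSolution.trans {α : ℝ} (hα : 1 / 2 < α) (hW : IsBrownianMotion W 𝓕 P)
    {B : PathSpace d T → HSqSpace d T} (hB : DriftAssumption B)
    {s u t : Set.Iic T} (hsu : s ≤ u) (hut : u ≤ t) {φ w v : RandomH P d T q}
    (hw : IsSolution hα W (driftExtension hB) s u φ w)
    (hv : IsSolution hα W (driftExtension hB) u t w v) :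
    IsSolution hα W (driftExtension hB) s t φ v := by
  have hs0 : (0 : ℝ) ≤ (s : ℝ≥0) := NNReal.coe_nonneg _
  have hu0 : (0 : ℝ) ≤ (u : ℝ≥0) := NNReal.coe_nonneg _
  have hsu' : ((s : ℝ≥0) : ℝ) ≤ (u : ℝ≥0) := NNReal.coe_le_coe.2 hsu
  have hut' : ((u : ℝ≥0) : ℝ) ≤ (t : ℝ≥0) := NNReal.coe_le_coe.2 hut
  have ht' : ((t : ℝ≥0) : ℝ) ≤ T := NNReal.coe_le_coe.2 t.2
  obtain ⟨Y₁, hY₁, hw⟩ := hw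
  obtain ⟨Y₂, hY₂, hv⟩ := hv
  obtain ⟨Y, hY, -⟩ := exists_noiseIntegral hW hα (hsu.trans hut)
  -- `Z` is the version of the integral over `[u, t]` known to vanish on `(0, u)`; this passes to
  -- `Y₂` by uniqueness.
  obtain ⟨Z, hZ, -, -, hZ0⟩ := exists_noiseIntegral hW hα hut
  refine ⟨Y, hY, ?_⟩
  filter_upwards [hw, hv, hY.ae_eq_add hW hsu hut hY₁ hY₂, hZ0, hZ.ae_unique hW hY₂]
    with ω h1 h2 h3 h4 h5
  refine ⟨intervalIntegrable_slice _ hs0 (hsu'.trans hut') ht', ?_⟩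
  have hvw : v ω = w ω + driftIntegral (driftExtension hB) (u : ℝ≥0) (t : ℝ≥0) (v ω) + Y₂ ω := h2.2
  have hagree : restrictBelow (u : ℝ≥0) (v ω - w ω) = 0 := by
    have : v ω - w ω = driftIntegral (driftExtension hB) (u : ℝ≥0) (t : ℝ≥0) (v ω) + Y₂ ω := by
      nth_rewrite 1 [hvw]
      abel
    rw [this, map_add, restrictBelow_driftIntegral hB hu0 hut' ht', ← h5, h4, add_zero]
  -- The drift over `[s, u]` may now be evaluated at `v` instead of `w`, so both drift integrals
  -- have the same argument and can be concatenated.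
  have hdrift := driftIntegral_congr hB hs0 hsu' (hut'.trans ht') hagree
  have hsplit := intervalIntegral.integral_add_adjacent_intervals
    (intervalIntegrable_slice (driftExtension hB (v ω)) hs0 hsu' (hut'.trans ht'))
    (intervalIntegrable_slice (driftExtension hB (v ω)) hu0 hut' ht')
  have hwφ : w ω = φ ω + driftIntegral (driftExtension hB) (s : ℝ≥0) (u : ℝ≥0) (v ω) + Y₁ ω := by
    rw [hdrift]
    exact h1.2
  rw [h3, ← hsplit]
  nth_rewrite 1 [hvw, hwφ]
  simp only [driftIntegral]
  abel

end Solution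

end SolutionMap

end VolterraSDE

end

/-! ### Assembly of the solution family and the cocycle property. -/

open VolterraSDE
theorem mainTheorem2
    {Ω : Type*} {m : MeasurableSpace Ω} {P : Measure Ω} [IsProbabilityMeasure P]
    (d : ℕ) (T : ℝ≥0) (hT : 0 < T)
    (α : ℝ) (hα : 1 / 2 < α) (hα' : α < 3 / 2)
    (𝓕 : Filtration (Set.Iic T) m) (h𝓕 : UsualConditions 𝓕 P)
    (W : ℝ≥0 → Ω → Rd d) (hW : IsBrownianMotion W 𝓕 P)
    (B : PathSpace d T → HSqSpace d T) (hB : DriftAssumption B)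
    (q : ℝ≥0) (hq : 2 ≤ q) :
    ∃ sol : Set.Iic T → Set.Iic T → RandomH P d T q → RandomH P d T q,
      (∀ (s t : Set.Iic T) (φ : RandomH P d T q), s ≤ t →
        IsSolution hα W (driftExtension hB) s t φ (sol s t φ) ∧
        ∀ w : RandomH P d T q, IsSolution hα W (driftExtension hB) s t φ w → w = sol s t φ) ∧
      (∀ (s t : Set.Iic T) (φ : RandomH P d T q), s ≤ t →
        φ ∈ lpMeas (HSpace d T) ℝ (𝓕 s) q P →
        sol s t φ ∈ lpMeas (HSpace d T) ℝ (𝓕 t) q P) ∧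
      (∀ (s u t : Set.Iic T) (φ : RandomH P d T q), s ≤ u → u ≤ t →
        sol s t φ = sol u t (sol s u φ)) := by
  classical
  choose sol hsol huniq hmeas using
    fun (s t : Set.Iic T) (φ : RandomH P d T q) (hst : s ≤ t) =>
      exists_solution hT hα hW hB hst φ
  -- The value `φ` when `t < s` is arbitrary; every assertion concerns ordered times only.
  refine ⟨fun s t φ => if h : s ≤ t then sol s t φ h else φ, fun s t φ hst => ?_,
    fun s t φ hst hφ => ?_, fun s u t φ hsu hut => ?_⟩
  · simp only [dif_pos hst]
    exact ⟨hsol s t φ hst, huniq s t φ hst⟩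
  · simp only [dif_pos hst]
    exact hmeas s t φ hst hφ
  · simp only [dif_pos hsu, dif_pos hut, dif_pos (hsu.trans hut)]
    exact (huniq s t φ _ _ ((hsol s u φ hsu).trans hα hW hB hsu hut (hsol u t _ hut))).symm
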